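/- Let $\ell\ge 2$, and let $\mathrm{Sp}_{2\ell}=\mathrm{Sp}_{2\ell}(\mathbb C)$ be the group of the matrices that preserve the alternating form with Gram matrix $K\cdot\mathrm{Diag}(1,\dots,1,-1,\dots,-1)$, where $K$ is the $2\ell\times 2\ell$ matrix with ones on the antidiagonal and there are $\ell$ entries $1$ and $\ell$ entries $-1$. Let $A$ be its subgroup of diagonal matrices, $N(A)$ the normalizer of $A$ in $\mathrm{Sp}_{2\ell}$, and $W=N(A)/A$ the Weyl group of type $C_\ell$. For $1\le k<\ell$ let $s_k\in N(A)$ be the permutation matrix that exchanges the basis vectors $k,k+1$ and also $2\ell-k,2\ell-k+1$; let $t_\ell\in N(A)$ be the identity except for the block $\begin{pmatrix}0&1\\-1&0\end{pmatrix}$ in rows and columns $\ell,\ell+1$; and put $t_k=s_ks_{k+1}\cdots s_{\ell-1}\,t_\ell\,s_{\ell-1}\cdots s_{k+1}s_k$ for $1\le k<\ell$. For a partition $\vec\ell=(\ell_\mu\ge\cdots\ge\ell_1)$ of $\ell$ into positive parts put $\ell'_\nu=\ell_1+\cdots+\ell_{\nu-1}$ and $$n_{\vec\ell}=\prod_{\nu=1}^{\mu}\bigl(s_{\ell'_\nu+1}s_{\ell'_\nu+2}\cdots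 s_{\ell'_\nu+\ell_\nu-1}\,t_{\ell'_\nu+\ell_\nu}\bigr),$$ the factors being taken in the order $\nu=1,\dots,\mu$. The conjugacy class in $W$ of the image of $n_{\vec\ell}$ is the elliptic class attached to $\vec\ell$. Let $G$ be a group of type $C_\ell$, given by a surjective homomorphism $\pi:\mathrm{Sp}_{2\ell}\to G$ with central kernel, with maximal torus $\pi(A)$. Identify $X_*(\pi(A))\otimes\mathbb R$ with $V=\mathbb R^\ell$, with simple roots $\alpha_k=e_k-e_{k+1}$ for $1\le k<\ell$ and $\alpha_\ell=2e_\ell$, highest root $\tilde\alpha=2\alpha_1+\cdots+2\alpha_{\ell-1}+\alpha_\ell=2e_1$, fundamental coweights $\check\omega_k=e_1+\cdots+e_k$ for $1\le k<\ell$ and $\check\omega_\ell=\frac12(e_1+\cdots+e_\ell)$, and closed fundamental alcove $\overline C=\{x\in V:\alpha_k(x)\ge0\text{ for all }k,\ \tilde\alpha(x)\le1\}$. Put $b_0=b_\ell=1$ and $b_k=2$ for $1\le k<\ell$. Let $g\in G$ have finite order $M$, and let $\xi$ be a primitive $M$-th root of unity. A Kac diagram of $g$ with respect to $\xi$ is a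 labeling of the nodes $\gamma_0,\gamma_1,\dots,\gamma_\ell$ of the affine Dynkin diagram of type $C_\ell$ that is obtained as follows. Take a cocharacter $\lambda$ of $\pi(A)$ such that $g$ is $G$-conjugate to $\lambda(\xi)$ and $\lambda/M\in\overline C$, and integers $s_0,\dots,s_\ell\ge0$ with $\lambda/M=\frac1M\sum_{k=1}^{\ell}s_k\check\omega_k$ and $M=\sum_{k=0}^{\ell}b_ks_k$; then label $\gamma_k$ by $s_k$ divided by the greatest common divisor of $s_0,\dots,s_\ell$. **Statement.** Let $\vec\ell$ be a partition of $\ell$, let $m=4\,\mathrm{lcm}(\ell_1,\dots,\ell_\mu)$, and let $\sigma_1\ge\sigma_2\ge\cdots\ge\sigma_\ell$ be the numbers $(2a-1)m/(4\ell_\nu)$ with $1\le\nu\le\mu$ and $1\le a\le\ell_\nu$, listed with multiplicity in decreasing order. Let $n\in N(A)$ be any element whose image in $W$ lies in the elliptic class attached to $\vec\ell$ (for example $n=n_{\vec\ell}$). Then $n$ has order $m$, the element $\pi(n)$ has finite order, and for every primitive root of unity $\xi$ whose order is that of $\pi(n)$, the element $\pi(n)$ has exactly one Kac diagram with respect to $\xi$.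 It is obtained from the labels $$m-2\sigma_1\ \text{at }\gamma_0,\qquad \sigma_k-\sigma_{k+1}\ \text{at }\gamma_k\ (1\le k\le\ell-1),\qquad 2\sigma_\ell\ \text{at }\gamma_\ell$$ by dividing all of them by their greatest common divisor. -/

import Mathlib

open scoped Matrix

noncomputable section

namespace KacC

/-! ### The symplectic group and its diagonal torus -/

/-- `Sp_{2ℓ}(ℂ)`.  The standard basis `1, …, ℓ, ℓ+1, …, 2ℓ` of `ℂ^{2ℓ}` is indexed by
`Fin ℓ ⊕ Fin ℓ`: `inl k` is the basis index `k` and `inr k` is the basis index `2ℓ + 1 - k`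
(with `k` counted from `1`).  Under this indexing the form whose matrix is the antidiagonal matrix
times `Diag(1, …, 1, -1, …, -1)` is the matrix `Matrix.J`. -/
abbrev Sp (ℓ : ℕ) : Type := ↥(Matrix.symplecticGroup (Fin ℓ) ℂ)

/-- The subgroup `A` of diagonal matrices in `Sp_{2ℓ}(ℂ)`. -/
def torus (ℓ : ℕ) : Subgroup (Sp ℓ) where
  carrier := {g | (g : Matrix (Fin ℓ ⊕ Fin ℓ) (Fin ℓ ⊕ Fin ℓ) ℂ).IsDiag}
  one_mem' := Matrix.isDiag_one
  mul_mem' := by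
    intro a b ha hb
    simp only [Set.mem_ofPred_eq, Submonoid.coe_mul] at *
    rw [← ha.diagonal_diag, ← hb.diagonal_diag, Matrix.diagonal_mul_diagonal]
    exact Matrix.isDiag_diagonal _
  inv_mem' := by
    intro a ha
    simp only [Set.mem_ofPred_eq, SymplecticGroup.coe_inv'] at *
    rw [← ha.diagonal_diag, Matrix.inv_diagonal]
    exact Matrix.isDiag_diagonal _

/-- The element `Diag(a₁, …, a_ℓ, a_ℓ⁻¹, …, a₁⁻¹)` of `A`. -/
def torusElt {ℓ : ℕ} (a : Fin ℓ → ℂˣ) : Sp ℓ :=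
  ⟨Matrix.fromBlocks (Matrix.diagonal fun k => (a k : ℂ)) 0
      0 (Matrix.diagonal fun k => ((a k)⁻¹ : ℂ)), by
    rw [SymplecticGroup.mem_iff]
    simp [Matrix.J, Matrix.fromBlocks_multiply, Matrix.fromBlocks_transpose,
      ← Matrix.diagonal_one, -Matrix.fromBlocks_diagonal]⟩

/-! ### Lifts of the simple reflections, and the elements `n` attached to partitions -/

/-- For a permutation `τ` of the first `ℓ` basis vectors, the element of `Sp_{2ℓ}` that permutes
both halves of the basis by `τ`. -/
def permElt {ℓ : ℕ} (τ : Equiv.Perm (Fin ℓ)) : Sp ℓ :=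
  ⟨Matrix.fromBlocks (τ.permMatrix ℂ) 0 0 (τ.permMatrix ℂ), by
    rw [SymplecticGroup.mem_iff]
    simp [Matrix.J, Matrix.fromBlocks_multiply, Matrix.fromBlocks_transpose,
      ← Matrix.permMatrix_mul]⟩

/-- The transposition of the (0-based) positions `k` and `k + 1`; the identity if `k + 1 ≥ ℓ`. -/
def adjSwap (ℓ k : ℕ) : Equiv.Perm (Fin ℓ) :=
  if h : k + 1 < ℓ then Equiv.swap ⟨k, by omega⟩ ⟨k + 1, h⟩ else 1

/-- The lift `s_{k+1}` of the simple reflection in `α_{k+1} = e_{k+1} - e_{k+2}`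
(`k` is 0-based). -/
def sElt (ℓ k : ℕ) : Sp ℓ := permElt (adjSwap ℓ k)

/-- The lift `t_ℓ` of the simple reflection in `α_ℓ = 2 e_ℓ`: it is the identity except on the two
middle basis vectors, where it is `!![0, 1; -1, 0]`. -/
def tLast (ℓ : ℕ) : Sp ℓ :=
  ⟨Matrix.fromBlocks
      (Matrix.diagonal fun k : Fin ℓ => if (k : ℕ) + 1 = ℓ then 0 else 1)
      (Matrix.diagonal fun k : Fin ℓ => if (k : ℕ) + 1 = ℓ then 1 else 0)
      (Matrix.diagonal fun k : Fin ℓ => if (k : ℕ) + 1 = ℓ then -1 else 0)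
      (Matrix.diagonal fun k : Fin ℓ => if (k : ℕ) + 1 = ℓ then 0 else 1), by
    rw [SymplecticGroup.mem_iff]
    simp only [Matrix.J, Matrix.fromBlocks_multiply, Matrix.fromBlocks_transpose,
      Matrix.diagonal_transpose, ← Matrix.diagonal_one, ← Matrix.diagonal_zero,
      Matrix.diagonal_mul_diagonal, Matrix.diagonal_add, Matrix.diagonal_neg]
    congr 2 <;> (ext k; split_ifs <;> simp)⟩

/-- The list `s_{a+1}, s_{a+2}, …, s_{a+r}`. -/
def sRun (ℓ a r : ℕ) : List (Sp ℓ) := (List.range' a r).map (sElt ℓ)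

/-- `t_{k+1} = s_{k+1} s_{k+2} ⋯ s_{ℓ-1} · t_ℓ · s_{ℓ-1} ⋯ s_{k+2} s_{k+1}` (`k` is 0-based). -/
def tElt (ℓ k : ℕ) : Sp ℓ :=
  (sRun ℓ k (ℓ - 1 - k)).prod * tLast ℓ * (sRun ℓ k (ℓ - 1 - k)).reverse.prod

/-- `c = s_{o+1} s_{o+2} ⋯ s_{o+r-1} · t_{o+r}`, the factor for a part `r ≥ 1` placed after
parts of total size `o`. -/
def cycleElt (ℓ o r : ℕ) : Sp ℓ := (sRun ℓ o (r - 1)).prod * tElt ℓ (o + r - 1)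

/-- The product of the factors `cycleElt` for a list of parts, the first one having offset `o`. -/
def partsElt (ℓ : ℕ) : ℕ → List ℕ → Sp ℓ
  | _, [] => 1
  | o, r :: rs => cycleElt ℓ o r * partsElt ℓ (o + r) rs

/-- The element `n` of `Sp_{2ℓ}` attached to a partition `ℓ₁ ≤ ℓ₂ ≤ ⋯ ≤ ℓ_μ` of `ℓ`; it is
`c₁ c₂ ⋯ c_μ` with `c_ν = cycleElt ℓ (ℓ₁ + ⋯ + ℓ_{ν-1}) ℓ_ν`. -/
def nElt {ℓ : ℕ} (p : ℓ.Partition) : Sp ℓ := partsElt ℓ 0 (p.parts.sort (· ≤ ·))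

/-- The normalizer `N(A)` of the diagonal torus in `Sp_{2ℓ}`. -/
abbrev normTorus (ℓ : ℕ) : Subgroup (Sp ℓ) := Subgroup.normalizer (torus ℓ : Set (Sp ℓ))

/-- The Weyl group `N(A)/A`. -/
abbrev Weyl (ℓ : ℕ) : Type := ↥(normTorus ℓ) ⧸ (torus ℓ).subgroupOf (normTorus ℓ)

theorem mem_torus_iff {ℓ : ℕ} (g : Sp ℓ) : g ∈ torus ℓ ↔ ∃ d e : Fin ℓ → ℂ,
    (g : Matrix (Fin ℓ ⊕ Fin ℓ) (Fin ℓ ⊕ Fin ℓ) ℂ) =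
      Matrix.fromBlocks (Matrix.diagonal d) 0 0 (Matrix.diagonal e) := by
  constructor
  · intro h
    refine ⟨fun k => g.1 (Sum.inl k) (Sum.inl k),
      fun k => g.1 (Sum.inr k) (Sum.inr k), ?_⟩
    rw [Matrix.fromBlocks_diagonal]
    conv_lhs => rw [← Matrix.IsDiag.diagonal_diag h]
    congr 1
    ext (k | k) <;> rfl
  · rintro ⟨d, e, h⟩
    change Matrix.IsDiag g.1
    rw [h, Matrix.fromBlocks_diagonal]
    exact Matrix.isDiag_diagonal _

theorem mem_normTorus_of_conj {ℓ : ℕ} (g : Sp ℓ) (h₁ : ∀ a ∈ torus ℓ, g * a * g⁻¹ ∈ torus ℓ)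
    (h₂ : ∀ a ∈ torus ℓ, g⁻¹ * a * g ∈ torus ℓ) : g ∈ normTorus ℓ := by
  rw [Subgroup.mem_normalizer_iff]
  refine fun a => ⟨h₁ a, fun h => ?_⟩
  simpa [mul_assoc] using h₂ _ h

theorem permElt_mem {ℓ : ℕ} (τ : Equiv.Perm (Fin ℓ)) : permElt τ ∈ normTorus ℓ := by
  have key : ∀ (τ : Equiv.Perm (Fin ℓ)), ∀ a ∈ torus ℓ,
      permElt τ * a * permElt τ⁻¹ ∈ torus ℓ := by
    intro τ a ha
    obtain ⟨d, e, h⟩ := (mem_torus_iff a).1 ha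
    have hP : ∀ f : Fin ℓ → ℂ, τ.permMatrix ℂ * Matrix.diagonal f * (τ⁻¹).permMatrix ℂ =
        Matrix.diagonal fun k => f (τ k) := by
      intro f
      ext i j
      simp only [Matrix.mul_apply, Equiv.Perm.permMatrix, PEquiv.toMatrix_apply,
        Matrix.diagonal_apply, Equiv.toPEquiv_apply, Option.mem_some_iff, ite_mul, mul_ite,
        one_mul, zero_mul, mul_one, mul_zero]
      rw [Finset.sum_eq_single (τ i)]
      · simp
      · intro k _ hk
        simp [Ne.symm hk]
      · simp
    refine (mem_torus_iff _).2 ⟨fun k => d (τ k), fun k => e (τ k), ?_⟩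
    simp [permElt, h, Matrix.fromBlocks_multiply, hP, -Matrix.fromBlocks_diagonal]
  have hinv : (permElt τ)⁻¹ = permElt τ⁻¹ := by
    rw [inv_eq_iff_mul_eq_one]
    ext1
    simp [permElt, Matrix.fromBlocks_multiply, ← Matrix.permMatrix_mul]
  refine mem_normTorus_of_conj _ (fun a ha => hinv ▸ key τ a ha) fun a ha => ?_
  simpa [hinv] using key τ⁻¹ a ha

theorem tLast_mem (ℓ : ℕ) : tLast ℓ ∈ normTorus ℓ := by
  refine mem_normTorus_of_conj _ (fun a ha => ?_) fun a ha => ?_ <;>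
  · obtain ⟨d, e, h⟩ := (mem_torus_iff a).1 ha
    refine (mem_torus_iff _).2 ⟨fun k => if (k : ℕ) + 1 = ℓ then e k else d k,
      fun k => if (k : ℕ) + 1 = ℓ then d k else e k, ?_⟩
    simp only [Submonoid.coe_mul, SymplecticGroup.coe_inv, h, tLast, Matrix.J,
      Matrix.fromBlocks_multiply, Matrix.fromBlocks_transpose, Matrix.fromBlocks_neg,
      Matrix.diagonal_transpose, ← Matrix.diagonal_one, ← Matrix.diagonal_zero,
      Matrix.diagonal_mul_diagonal, Matrix.diagonal_add, Matrix.diagonal_neg]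
    congr 2 <;> (ext k; by_cases hk : (k : ℕ) + 1 = ℓ <;> simp [hk])

theorem sRun_mem (ℓ a r : ℕ) : ∀ g ∈ sRun ℓ a r, g ∈ normTorus ℓ := by
  intro g hg
  obtain ⟨k, -, rfl⟩ := List.mem_map.1 hg
  exact permElt_mem _

theorem cycleElt_mem (ℓ o r : ℕ) : cycleElt ℓ o r ∈ normTorus ℓ := by
  refine mul_mem (list_prod_mem (sRun_mem _ _ _)) (mul_mem (mul_mem
    (list_prod_mem (sRun_mem _ _ _)) (tLast_mem _)) (list_prod_mem fun g hg => ?_))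
  exact sRun_mem _ _ _ g (List.mem_reverse.1 hg)

theorem partsElt_mem (ℓ : ℕ) (L : List ℕ) : ∀ o, partsElt ℓ o L ∈ normTorus ℓ := by
  induction L with
  | nil => exact fun _ => one_mem _
  | cons r rs ih => exact fun o => mul_mem (cycleElt_mem _ _ _) (ih _)

theorem nElt_mem {ℓ : ℕ} (p : ℓ.Partition) : nElt p ∈ normTorus ℓ := partsElt_mem _ _ _

/-- The image of `n ∈ N(A)` in the Weyl group. -/
def toWeyl {ℓ : ℕ} (n : ↥(normTorus ℓ)) : Weyl ℓ := QuotientGroup.mk n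

/-- The conjugacy class of the Weyl group of type `C_ℓ` attached to a partition `p` of `ℓ`: the
class of the image of `nElt p` (signed permutations whose cycles are all negative, with
the parts of `p` as lengths). -/
def ellipticClass {ℓ : ℕ} (p : ℓ.Partition) : ConjClasses (Weyl ℓ) :=
  ConjClasses.mk (toWeyl ⟨nElt p, nElt_mem p⟩)

/-! ### The fundamental alcove of type `C_ℓ`

`V = ℝ^ℓ`, with simple roots `α_k = e_k - e_{k+1}` for `1 ≤ k < ℓ` and `α_ℓ = 2 e_ℓ`.  The nodes
of the affine Dynkin diagram `γ_0 ⇒ γ_1 — ⋯ — γ_{ℓ-1} ⇐ γ_ℓ` are indexed by `Fin (ℓ + 1)`. -/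

/-- The simple root `α_{k+1}`, as a function on `V` (`k` is 0-based). -/
def simpleRoot {ℓ : ℕ} (k : Fin ℓ) (v : Fin ℓ → ℝ) : ℝ :=
  if h : (k : ℕ) + 1 < ℓ then v k - v ⟨k + 1, h⟩ else 2 * v k

/-- The fundamental coweight dual to `α_{k+1}` (`k` is 0-based): `e_1 + ⋯ + e_{k+1}`, or
`(e_1 + ⋯ + e_ℓ) / 2` if `k + 1 = ℓ`. -/
def coweight {ℓ : ℕ} (k : Fin ℓ) : Fin ℓ → ℝ :=
  fun j => if j ≤ k then (if (k : ℕ) + 1 = ℓ then 1 / 2 else 1) else 0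

/-- The coefficient `b_γ = c_γ` at a node of the affine Dynkin diagram: `1, 2, 2, …, 2, 1`. -/
def nodeCoeff {ℓ : ℕ} (i : Fin (ℓ + 1)) : ℤ :=
  if (i : ℕ) = 0 ∨ (i : ℕ) = ℓ then 1 else 2

/-- The highest root `∑ c_γ γ = 2 α_1 + ⋯ + 2 α_{ℓ-1} + α_ℓ`. -/
def highestRoot {ℓ : ℕ} (v : Fin ℓ → ℝ) : ℝ :=
  ∑ k : Fin ℓ, (nodeCoeff k.succ : ℝ) * simpleRoot k v

/-- The closure of the fundamental alcove. -/
def closedAlcove (ℓ : ℕ) : Set (Fin ℓ → ℝ) :=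
  {v | (∀ k, 0 ≤ simpleRoot k v) ∧ highestRoot v ≤ 1}

/-! ### Kac diagrams

A semisimple group of type `C_ℓ` is presented as a group `G` with a surjective homomorphism
`π : Sp_{2ℓ} → G` with central kernel (`Sp_{2ℓ}` is simply connected).  Its maximal torus is
`π(A)`. -/

/-- The cocharacters of the torus `π(A)`, as a lattice in `V`: those `v` for which
`exp v = Diag(e^{2πi v_1}, …, e^{2πi v_ℓ}, e^{-2πi v_ℓ}, …, e^{-2πi v_1})` has trivial image
in `G`. -/
def IsCocharacter {ℓ : ℕ} {G : Type*} [Group G] (π : Sp ℓ →* G) (v : Fin ℓ → ℝ) : Prop :=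
  π (torusElt fun j => Units.mk0 (Complex.exp (2 * Real.pi * Complex.I * (v j : ℂ)))
    (Complex.exp_ne_zero _)) = 1

/-- The value of the cocharacter `v` of `π(A)` at `z`: the image in `G` of
`Diag(z^{v_1}, …, z^{v_ℓ}, z^{-v_ℓ}, …, z^{-v_1})`.  For a cocharacter `v`, another choice of
`log z` in the definition of the powers changes this matrix by an element of `ker π`. -/
def cocharValue {ℓ : ℕ} {G : Type*} [Group G] (π : Sp ℓ →* G) (v : Fin ℓ → ℝ) (z : ℂˣ) : G :=
  π (torusElt fun j => Units.mk0 ((z : ℂ) ^ ((v j : ℝ) : ℂ))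
    (by simp [Complex.cpow_eq_zero_iff]))

/-- Remove all common factors from a family of labels. -/
def removeCommonFactors {ι : Type*} [Fintype ι] (s : ι → ℤ) : ι → ℤ :=
  fun i => s i / Finset.univ.gcd s

/-- `d` is a Kac diagram for the element `g` of finite order `m` in `G`, with respect to the
primitive `m`-th root of unity `ξ`: there is a cocharacter `v` of the maximal torus such that `g` is
`G`-conjugate to `v(ξ)` and `x = v/m` is in the closure of the fundamental alcove, and `d`
is obtained by removing the common factors from the non-negative integers `s_γ` with
`x = (1/m) ∑_{k=1}^ℓ s_k ω̌_k` and `m = ∑_γ b_γ s_γ`. -/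
def IsKacDiagram {ℓ : ℕ} {G : Type*} [Group G] (π : Sp ℓ →* G) (ξ : ℂˣ) (g : G)
    (d : Fin (ℓ + 1) → ℤ) : Prop :=
  IsOfFinOrder g ∧ IsPrimitiveRoot ξ (orderOf g) ∧
  ∃ (v : Fin ℓ → ℝ) (s : Fin (ℓ + 1) → ℤ),
    IsCocharacter π v ∧
    IsConj g (cocharValue π v ξ) ∧
    (orderOf g : ℝ)⁻¹ • v ∈ closedAlcove ℓ ∧
    (∀ i, 0 ≤ s i) ∧
    (orderOf g : ℝ)⁻¹ • v = (orderOf g : ℝ)⁻¹ • ∑ k : Fin ℓ, (s k.succ : ℝ) • coweight k ∧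
    (orderOf g : ℤ) = ∑ i, nodeCoeff i * s i ∧
    d = removeCommonFactors s

/-! ### The explicit labels -/

/-- `m = 4 lcm(ℓ_1, …, ℓ_μ)`. -/
def bigM {ℓ : ℕ} (p : ℓ.Partition) : ℕ := 4 * p.parts.lcm

/-- The list of the numbers `(2a - 1) m / (4 ℓ_ν)`, `1 ≤ ν ≤ μ`, `1 ≤ a ≤ ℓ_ν`, in decreasing
order. -/
def sigmaList {ℓ : ℕ} (p : ℓ.Partition) : List ℕ :=
  (p.parts.bind fun r => (Finset.Icc 1 r).val.map fun a =>
    (2 * a - 1) * bigM p / (4 * r)).sort (· ≥ ·)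

/-- The `i`-th entry `σ_i` of the list, for `1 ≤ i ≤ ℓ`. -/
def sigma {ℓ : ℕ} (p : ℓ.Partition) (i : ℕ) : ℤ := ((sigmaList p).getD (i - 1) 0 : ℕ)

/-- The labels `m - 2σ_1, σ_1 - σ_2, …, σ_{ℓ-1} - σ_ℓ, 2σ_ℓ` at the nodes `γ_0, …, γ_ℓ`. -/
def labels {ℓ : ℕ} (p : ℓ.Partition) (i : Fin (ℓ + 1)) : ℤ :=
  if (i : ℕ) = 0 then bigM p - 2 * sigma p 1
  else if (i : ℕ) = ℓ then 2 * sigma p ℓ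
  else sigma p i - sigma p (i + 1)

end KacC

end

/-!
Up to conjugacy, a lift `n` of an element of the elliptic class permutes the lines spanned by the
basis vectors in negative cycles, one for each part `r`, and `n ^ (2 * r)` acts as `-1` on the
lines of such a cycle. Averaging over the orbits gives a symplectic basis of eigenvectors whose
eigenvalues are, for each `r`, the `2 * r`-th roots of `-1`. They are the numbers `e ^ (±2πikx_j)`
for the point `x = (σ₁, …, σ_ℓ) / m` of the alcove and any `k` coprime to `m`, so `n` is conjugate
to `exp (k • x)` for all these `k`. The kernel of `π` lies in `{1, -1}` and `-n` is again a lift,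
so conjugacy with `π n` in `G` lifts to conjugacy with `n` in `Sp`. There the eigenvalues separate
the points of the alcove, since `y ↦ cos (2πy)` is injective on `[0, 1 / 2]`, and `x` is the only
point that gives a Kac diagram.
-/

noncomputable section

namespace KacC

section Eigenvectors

variable {R V : Type*} [CommRing R] [AddCommGroup V] [Module R V]

/-- The sum `∑ z⁻ʲ fʲ x` over `j < n`: when `fⁿ x = zⁿ x`, it is `n` times the projection of `x` to
the eigenspace of `f` for the eigenvalue `z`. -/
def eigenSum (f : Module.End R V) (n : ℕ) (x : V) (z : Rˣ) : V :=
  ∑ j ∈ Finset.range n, ((z⁻¹ : Rˣ) : R) ^ j • (f ^ j) x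

theorem apply_eigenSum {f : Module.End R V} {n : ℕ} {x : V} {z : Rˣ}
    (hx : (f ^ n) x = (z : R) ^ n • x) : f (eigenSum f n x z) = (z : R) • eigenSum f n x z := by
  have cyclic := (Finset.sum_range_succ' (fun j => ((z⁻¹ : Rˣ) : R) ^ j • (f ^ j) x) n).symm.trans
    (Finset.sum_range_succ _ _)
  simp only [hx, smul_smul, ← mul_pow, Units.inv_mul, one_pow, pow_zero, Module.End.one_apply,
    one_smul, add_left_inj] at cyclic
  conv_rhs => rw [eigenSum, ← cyclic, Finset.smul_sum]
  rw [eigenSum, map_sum]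
  refine Finset.sum_congr rfl fun j _ => ?_
  rw [map_smul, smul_smul, pow_succ', Units.mul_inv_cancel_left, pow_succ', Module.End.mul_apply]

theorem pow_apply_eq_smul {f : Module.End R V} {w : V} {z : R} (hw : f w = z • w) (i : ℕ) :
    (f ^ i) w = z ^ i • w := by
  induction i with
  | zero => simp
  | succ i ih => rw [pow_succ', Module.End.mul_apply, ih, map_smul, hw, smul_smul, ← pow_succ]

variable {B : LinearMap.BilinForm R V} {f : Module.End R V}

theorem isOrthogonal_pow (hf : B.IsOrthogonal f) (i : ℕ) : B.IsOrthogonal ⇑(f ^ i) := by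
  induction i with
  | zero => exact fun _ _ => rfl
  | succ i ih =>
    intro v w
    rw [pow_succ, Module.End.mul_apply, Module.End.mul_apply, ih, hf]

theorem form_eq_zero_of_eigenvectors [IsDomain R] (hf : B.IsOrthogonal f) {v w : V} {y z : R}
    (hv : f v = y • v) (hw : f w = z • w) (hyz : y * z ≠ 1) : B v w = 0 := by
  have invariant := hf v w
  rw [hv, hw, map_smul, map_smul, LinearMap.smul_apply, smul_smul, smul_eq_mul, mul_comm z]
    at invariant
  by_contra hB
  exact hyz ((mul_eq_right₀ hB).1 invariant)

theorem form_eigenSum_left (hf : B.IsOrthogonal f) {n : ℕ} {x w : V} {y z : Rˣ}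
    (hw : f w = (z : R) • w) :
    B (eigenSum f n x y) w = (∑ i ∈ Finset.range n, (((y * z)⁻¹ : Rˣ) : R) ^ i) * B x w := by
  rw [eigenSum, map_sum, LinearMap.sum_apply, Finset.sum_mul]
  refine Finset.sum_congr rfl fun i _ => ?_
  have invariant := isOrthogonal_pow hf i x w
  rw [pow_apply_eq_smul hw, map_smul, smul_eq_mul] at invariant
  rw [map_smul, LinearMap.smul_apply, smul_eq_mul, ← invariant, ← mul_assoc, ← mul_pow, mul_inv,
    Units.val_mul, Units.inv_mul_cancel_right]

theorem form_eigenSum_right_eq_zero {n : ℕ} {x x' : V} (h : ∀ j < n, B x' ((f ^ j) x) = 0)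
    (z : Rˣ) : B x' (eigenSum f n x z) = 0 := by
  rw [eigenSum, map_sum]
  exact Finset.sum_eq_zero fun j hj => by rw [map_smul, h j (Finset.mem_range.1 hj), smul_zero]

/-- A vector `x` with `f²ʳ x = -x` whose first `2r` images under `f` form, up to scalars and order,
a symplectic basis of their span: `fʳ x` is the only one that is not orthogonal to `x`. -/
structure IsNegOrbit (B : LinearMap.BilinForm R V) (f : Module.End R V) (r : ℕ) (x : V) :
    Prop where
  pow_apply : (f ^ (2 * r)) x = -x
  form_eq_zero : ∀ j < 2 * r, j ≠ r → B x ((f ^ j) x) = 0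
  form_ne_zero : B x ((f ^ r) x) ≠ 0

theorem pow_two_mul_apply_eq_neg [IsDomain R] (hB : B.IsAlt) (hf : B.IsOrthogonal f) {r : ℕ}
    {x : V} {d : R} (hd : (f ^ (2 * r)) x = d • x) (hx : B x ((f ^ r) x) ≠ 0) :
    (f ^ (2 * r)) x = -x := by
  have invariant := isOrthogonal_pow hf r x ((f ^ r) x)
  rw [← Module.End.mul_apply, ← pow_add, ← two_mul, hd, map_smul, ← hB.neg_eq x, smul_neg,
    ← neg_smul, smul_eq_mul] at invariant
  rw [hd, neg_eq_iff_eq_neg.1 ((mul_eq_right₀ hx).1 invariant), neg_one_smul]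

theorem IsNegOrbit.apply_eigenSum {r : ℕ} {x : V} (hx : IsNegOrbit B f r x) {z : Rˣ}
    (hz : z ^ (2 * r) = -1) :
    f (eigenSum f (2 * r) x z) = (z : R) • eigenSum f (2 * r) x z := by
  refine KacC.apply_eigenSum ?_
  rw [hx.pow_apply, ← Units.val_pow_eq_pow_val, hz, Units.val_neg, Units.val_one, neg_one_smul]

theorem IsNegOrbit.form_eigenSum_ne_zero [IsDomain R] [CharZero R] (hf : B.IsOrthogonal f) {r : ℕ}
    {x : V} (hx : IsNegOrbit B f r x) (hr : r ≠ 0) {z : Rˣ} (hz : z ^ (2 * r) = -1) :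
    B (eigenSum f (2 * r) x z) (eigenSum f (2 * r) x z⁻¹) ≠ 0 := by
  have hz' : z⁻¹ ^ (2 * r) = -1 := by rw [inv_pow, hz, inv_neg_one]
  have middle_term : B x (eigenSum f (2 * r) x z⁻¹) = (z : R) ^ r * B x ((f ^ r) x) := by
    rw [eigenSum, map_sum, Finset.sum_eq_single_of_mem r (Finset.mem_range.2 (by lia)), map_smul,
      inv_inv, smul_eq_mul]
    intro j hj hjr
    rw [map_smul, hx.form_eq_zero j (Finset.mem_range.1 hj) hjr, smul_zero]
  rw [form_eigenSum_left hf (hx.apply_eigenSum hz'), middle_term]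
  refine mul_ne_zero ?_ (mul_ne_zero (pow_ne_zero _ z.ne_zero) hx.form_ne_zero)
  simp [hr]

end Eigenvectors

section SymplecticGroup

variable {l R : Type*} [DecidableEq l] [Fintype l] [CommRing R]

variable (l R) in
/-- The standard representation of the symplectic group, on column vectors. -/
def stdRep : Matrix.symplecticGroup l R →* Module.End R (l ⊕ l → R) :=
  (Matrix.toLinAlgEquiv' : Matrix (l ⊕ l) (l ⊕ l) R ≃ₐ[R] _).toMonoidHom.comp
    (Matrix.symplecticGroup l R).subtype

variable (l R) in
/-- The alternating form preserved by the symplectic group. -/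
def stdForm : LinearMap.BilinForm R (l ⊕ l → R) := (Matrix.J l R).toBilin'

theorem stdRep_apply (g : Matrix.symplecticGroup l R) (v : l ⊕ l → R) :
    stdRep l R g v = g.1 *ᵥ v := rfl

theorem stdForm_apply (v w : l ⊕ l → R) : stdForm l R v w = v ⬝ᵥ Matrix.J l R *ᵥ w :=
  Matrix.toBilin'_apply' _ _ _

theorem stdForm_elim (v v' w w' : l → R) :
    stdForm l R (Sum.elim v v') (Sum.elim w w') = v' ⬝ᵥ w - v ⬝ᵥ w' := by
  simp [stdForm_apply, Matrix.J, Matrix.fromBlocks_mulVec, Matrix.neg_mulVec, sub_eq_neg_add]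

theorem isAlt_stdForm : (stdForm l R).IsAlt := fun v => by
  rw [← Sum.elim_comp_inl_inr v, stdForm_elim, dotProduct_comm, sub_self]

theorem isOrthogonal_stdRep (g : Matrix.symplecticGroup l R) :
    (stdForm l R).IsOrthogonal (stdRep l R g) := fun v w => by
  rw [stdForm_apply, stdForm_apply, stdRep_apply, stdRep_apply, ← Matrix.vecMul_transpose,
    ← Matrix.dotProduct_mulVec, Matrix.mulVec_mulVec, Matrix.mulVec_mulVec,
    SymplecticGroup.mem_iff'.1 g.2]

theorem of_transpose_mem_symplecticGroup {b : l ⊕ l → l ⊕ l → R}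
    (hb : ∀ i j, stdForm l R (b i) (b j) = Matrix.J l R i j) :
    (Matrix.of b)ᵀ ∈ Matrix.symplecticGroup l R := by
  rw [SymplecticGroup.mem_iff', Matrix.transpose_transpose]
  ext i j
  rw [← hb, stdForm_apply, Matrix.mul_assoc]
  rfl

/-- An element of the unipotent radical of the Siegel parabolic subgroup. -/
def upperUnipotent (S : Matrix l l R) (hS : S.IsSymm) : Matrix.symplecticGroup l R :=
  ⟨Matrix.fromBlocks 1 S 0 1, by rw [SymplecticGroup.fromBlocks_mem_iff]; simp [hS.eq]⟩

theorem exists_eq_fromBlocks_of_mem_center {z : Matrix.symplecticGroup l R}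
    (hz : z ∈ Subgroup.center (Matrix.symplecticGroup l R)) :
    ∃ A : Matrix l l R, z.1 = Matrix.fromBlocks A 0 0 A ∧ ∀ S : Matrix l l R, S.IsSymm →
      Commute S A := by
  have commutes (g : Matrix.symplecticGroup l R) : g.1 * z.1 = z.1 * g.1 :=
    congrArg Subtype.val (Subgroup.mem_center_iff.1 hz g)
  obtain ⟨A, B, C, D, hM⟩ : ∃ A B C D, z.1 = Matrix.fromBlocks A B C D :=
    ⟨_, _, _, _, (Matrix.fromBlocks_toBlocks z.1).symm⟩
  have with_J := commutes (SymplecticGroup.symJ l R)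
  have with_unipotent (S : Matrix l l R) (hS : S.IsSymm) := commutes (upperUnipotent S hS)
  simp only [hM, SymplecticGroup.coe_J, Matrix.J, upperUnipotent, Matrix.fromBlocks_multiply,
    Matrix.fromBlocks_inj, neg_mul, mul_neg, one_mul, mul_one, zero_mul, mul_zero, zero_add,
    add_zero, neg_inj] at with_J with_unipotent
  have hC : C = 0 := by simpa using (with_unipotent 1 Matrix.isSymm_one).1
  have hB : B = 0 := by simpa [hC] using with_J.1.symm
  obtain rfl : D = A := with_J.2.1
  refine ⟨D, by rw [hM, hB, hC], fun S hS => ?_⟩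
  simpa [hB] using! (with_unipotent S hS).2.1

theorem mem_range_scalar_of_commute_isSymm {A : Matrix l l R}
    (hA : ∀ S : Matrix l l R, S.IsSymm → Commute S A) : A ∈ Set.range (Matrix.scalar l) := by
  refine Matrix.mem_range_scalar_of_commute_single fun i j hij => ?_
  have factorization : Matrix.single i j (1 : R) =
      Matrix.single i i 1 * (Matrix.single i j 1 + Matrix.single j i 1) := by
    simp [mul_add, hij]
  change Commute _ A
  rw [factorization]
  exact (hA _ (by simp [Matrix.IsSymm])).mul_left (hA _ (by simp [Matrix.IsSymm, add_comm]))

theorem coe_eq_one_or_neg_one_of_mem_center [IsDomain R] {z : Matrix.symplecticGroup l R}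
    (hz : z ∈ Subgroup.center (Matrix.symplecticGroup l R)) : z.1 = 1 ∨ z.1 = -1 := by
  obtain ⟨A, hzA, hA⟩ := exists_eq_fromBlocks_of_mem_center hz
  obtain ⟨c, rfl⟩ := mem_range_scalar_of_commute_isSymm hA
  have sq_eq_one : Matrix.scalar l (c * c) = 1 := by
    have hmem := z.2
    rw [hzA, SymplecticGroup.fromBlocks_mem_iff] at hmem
    simpa using hmem.2.2
  rcases isEmpty_or_nonempty l with _ | _
  · exact .inl (Subsingleton.elim _ _)
  · rw [← map_one (Matrix.scalar l), Matrix.scalar_inj, mul_self_eq_one_iff] at sq_eq_one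
    rcases sq_eq_one with rfl | rfl
    · exact .inl (by rw [hzA, map_one, Matrix.fromBlocks_one])
    · exact .inr (by
        rw [hzA, map_neg, map_one, ← Matrix.fromBlocks_one, Matrix.fromBlocks_neg, neg_zero])

end SymplecticGroup

section Torus

variable {ℓ : ℕ}

theorem coe_torusElt (a : Fin ℓ → ℂˣ) :
    (torusElt a : Matrix (Fin ℓ ⊕ Fin ℓ) (Fin ℓ ⊕ Fin ℓ) ℂ) =
      Matrix.diagonal (Sum.elim (fun k => (a k : ℂ)) fun k => ((a k)⁻¹ : ℂˣ)) := by
  simp [torusElt]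

theorem isConj_torusElt_of_eigenbasis {g : Sp ℓ} {a : Fin ℓ → ℂˣ}
    {u w : Fin ℓ → Fin ℓ ⊕ Fin ℓ → ℂ}
    (hu : ∀ k, stdRep (Fin ℓ) ℂ g (u k) = (a k : ℂ) • u k)
    (hw : ∀ k, stdRep (Fin ℓ) ℂ g (w k) = ((a k)⁻¹ : ℂˣ) • w k)
    (hb : ∀ i j, stdForm (Fin ℓ) ℂ (Sum.elim u w i) (Sum.elim u w j) = Matrix.J (Fin ℓ) ℂ i j) :
    IsConj g (torusElt a) := by
  refine IsConj.symm (isConj_iff.2 ⟨⟨_, of_transpose_mem_symplecticGroup hb⟩, ?_⟩)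
  rw [mul_inv_eq_iff_eq_mul]
  ext i j
  change ((Matrix.of (Sum.elim u w))ᵀ * (torusElt a).1) i j =
    stdRep (Fin ℓ) ℂ g (Sum.elim u w j) i
  rw [coe_torusElt, Matrix.mul_diagonal]
  rcases j with j | j
  · simp [hu, mul_comm]
  · simp [hw, mul_comm, Units.smul_def]

theorem isConj_torusElt_of_eigenvectors {g : Sp ℓ} {a : Fin ℓ → ℂˣ}
    {u w : Fin ℓ → Fin ℓ ⊕ Fin ℓ → ℂ}
    (hu : ∀ k, stdRep (Fin ℓ) ℂ g (u k) = (a k : ℂ) • u k)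
    (hw : ∀ k, stdRep (Fin ℓ) ℂ g (w k) = ((a k)⁻¹ : ℂˣ) • w k)
    (huu : ∀ j k, stdForm (Fin ℓ) ℂ (u j) (u k) = 0)
    (hww : ∀ j k, stdForm (Fin ℓ) ℂ (w j) (w k) = 0)
    (huw : ∀ j k, j ≠ k → stdForm (Fin ℓ) ℂ (u j) (w k) = 0)
    (huw_ne : ∀ k, stdForm (Fin ℓ) ℂ (u k) (w k) ≠ 0) : IsConj g (torusElt a) := by
  set c : Fin ℓ → ℂ := fun k => -(stdForm (Fin ℓ) ℂ (u k) (w k))⁻¹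
  have pairing (j k) : stdForm (Fin ℓ) ℂ (u j) (c k • w k) = if j = k then -1 else 0 := by
    split_ifs with hjk
    · rw [hjk, map_smul, smul_eq_mul, neg_mul, inv_mul_cancel₀ (huw_ne k)]
    · rw [map_smul, huw j k hjk, smul_zero]
  refine isConj_torusElt_of_eigenbasis (u := u) (w := fun k => c k • w k) hu
    (fun k => by rw [map_smul, hw, smul_comm]) ?_
  rintro (j | j) (k | k)
  · simp [huu, Matrix.J]
  · simp [pairing, Matrix.J, Matrix.one_apply, apply_ite]
  · rw [Sum.elim_inr, Sum.elim_inl, ← isAlt_stdForm.neg_eq, pairing]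
    simp [Matrix.J, Matrix.one_apply, apply_ite, eq_comm (a := k)]
  · simp [hww, Matrix.J]

theorem isConj_torusElt_of_isNegOrbit {ι : Type*} {g : Sp ℓ} {r : ι → ℕ}
    {x : ι → Fin ℓ ⊕ Fin ℓ → ℂ} (hr : ∀ ν, r ν ≠ 0)
    (hx : ∀ ν, IsNegOrbit (stdForm (Fin ℓ) ℂ) (stdRep (Fin ℓ) ℂ g) (r ν) (x ν))
    (horth : ∀ ν ν', ν ≠ ν' → ∀ j < 2 * r ν',
      stdForm (Fin ℓ) ℂ (x ν) ((stdRep (Fin ℓ) ℂ g ^ j) (x ν')) = 0)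
    (e : Fin ℓ → ι) {z : Fin ℓ → ℂˣ} (hz : ∀ k, z k ^ (2 * r (e k)) = -1)
    (hmul : ∀ j k, e j = e k → z j * z k ≠ 1)
    (hinj : ∀ j k, e j = e k → z j = z k → j = k) : IsConj g (torusElt z) := by
  have hg := isOrthogonal_stdRep g
  have hz' (k) : (z k)⁻¹ ^ (2 * r (e k)) = -1 := by rw [inv_pow, hz, inv_neg_one]
  let u (k : Fin ℓ) (y : ℂˣ) := eigenSum (stdRep (Fin ℓ) ℂ g) (2 * r (e k)) (x (e k)) y
  have eigen (k y) (hy : y ^ (2 * r (e k)) = -1) : stdRep (Fin ℓ) ℂ g (u k y) = (y : ℂ) • u k y :=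
    (hx (e k)).apply_eigenSum hy
  have orthogonal (j k y y') (hy : y ^ (2 * r (e j)) = -1) (hy' : y' ^ (2 * r (e k)) = -1)
      (hne : e j = e k → y * y' ≠ 1) : stdForm (Fin ℓ) ℂ (u j y) (u k y') = 0 := by
    by_cases hjk : e j = e k
    · exact form_eq_zero_of_eigenvectors hg (eigen j y hy) (eigen k y' hy')
        fun h => hne hjk (Units.ext h)
    · rw [form_eigenSum_left hg (eigen k y' hy'), form_eigenSum_right_eq_zero (horth _ _ hjk),
        mul_zero]
  refine isConj_torusElt_of_eigenvectors (fun k => eigen k _ (hz k)) (fun k => eigen k _ (hz' k))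
    (fun j k => orthogonal j k _ _ (hz j) (hz k) (hmul j k))
    (fun j k => orthogonal j k _ _ (hz' j) (hz' k) fun hjk h => hmul j k hjk ?_)
    (fun j k hne => orthogonal j k _ _ (hz j) (hz' k) fun hjk h =>
      hne (hinj j k hjk (mul_inv_eq_one.1 h)))
    (fun k => (hx (e k)).form_eigenSum_ne_zero hg (hr _) (hz k))
  rwa [← mul_inv, inv_eq_one] at h

end Torus

section MapsLine

variable {ℓ : ℕ}

theorem exists_eq_torusElt_of_mem_torus {a : Sp ℓ} (ha : a ∈ torus ℓ) : ∃ t, a = torusElt t := by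
  obtain ⟨d, e, hde⟩ := (mem_torus_iff a).1 ha
  have hmem := a.2
  rw [hde, SymplecticGroup.fromBlocks_mem_iff] at hmem
  have hd_mul (k) : d k * e k = 1 := by simpa using congrFun₂ hmem.2.2 k k
  refine ⟨fun k => Units.mkOfMulEqOne (d k) (e k) (hd_mul k), Subtype.ext ?_⟩
  rw [hde, torusElt]
  simp [eq_inv_of_mul_eq_one_right (hd_mul _)]

variable (ℓ) in
/-- The standard basis of `ℂ^{2ℓ}`: `(false, k)` stands for the `k`-th vector of the first half
(`k` is 0-based) and `(true, k)` for the one paired with it. The vector is zero for `k ≥ ℓ`. -/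
def basisVec : Bool × ℕ → Fin ℓ ⊕ Fin ℓ → ℂ
  | (false, k) => Sum.elim (fun j => if (j : ℕ) = k then 1 else 0) 0
  | (true, k) => Sum.elim 0 (fun j => if (j : ℕ) = k then 1 else 0)

theorem basisVec_of_le {k : ℕ} (hk : ℓ ≤ k) (b : Bool) : basisVec ℓ (b, k) = 0 := by
  have (j : Fin ℓ) : ¬ (j : ℕ) = k := by lia
  cases b <;> · ext (j | j) <;> simp [basisVec, this]

theorem stdForm_basisVec_same_half (b : Bool) (j k : ℕ) :
    stdForm (Fin ℓ) ℂ (basisVec ℓ (b, j)) (basisVec ℓ (b, k)) = 0 := by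
  cases b <;> simp [basisVec, stdForm_elim]

theorem stdForm_basisVec_of_ne (b c : Bool) {j k : ℕ} (hjk : j ≠ k) :
    stdForm (Fin ℓ) ℂ (basisVec ℓ (b, j)) (basisVec ℓ (c, k)) = 0 := by
  have disjoint (j k : ℕ) (hjk : j ≠ k) : (fun i : Fin ℓ => if (i : ℕ) = j then (1 : ℂ) else 0) ⬝ᵥ
      (fun i : Fin ℓ => if (i : ℕ) = k then (1 : ℂ) else 0) = 0 :=
    Finset.sum_eq_zero fun i _ => by dsimp only; split_ifs <;> simp_all
  cases b <;> cases c <;> simp [basisVec, stdForm_elim, disjoint j k hjk]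

theorem stdForm_basisVec_paired {j : ℕ} (hj : j < ℓ) :
    stdForm (Fin ℓ) ℂ (basisVec ℓ (false, j)) (basisVec ℓ (true, j)) = -1 := by
  rw [basisVec, basisVec, stdForm_elim, zero_dotProduct, zero_sub, neg_inj, dotProduct,
    Finset.sum_eq_single ⟨j, hj⟩] <;> simp +contextual [Fin.ext_iff]

/-- `g` maps the line of the basis vector `x` onto the line of the basis vector `y`. -/
def MapsLine (g : Sp ℓ) (x y : Bool × ℕ) : Prop :=
  ∃ c : ℂˣ, stdRep (Fin ℓ) ℂ g (basisVec ℓ x) = c • basisVec ℓ y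

theorem mapsLine_one (x : Bool × ℕ) : MapsLine (1 : Sp ℓ) x x := ⟨1, by simp⟩

theorem MapsLine.mul {g h : Sp ℓ} {x y z : Bool × ℕ} (hg : MapsLine g y z) (hh : MapsLine h x y) :
    MapsLine (g * h) x z := by
  obtain ⟨c, hc⟩ := hg
  obtain ⟨d, hd⟩ := hh
  refine ⟨d * c, ?_⟩
  rw [map_mul, Module.End.mul_apply, hd, LinearMap.map_smul_of_tower, hc, smul_smul]

theorem MapsLine.inv {g : Sp ℓ} {x y : Bool × ℕ} (hg : MapsLine g x y) : MapsLine g⁻¹ y x := by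
  obtain ⟨c, hc⟩ := hg
  refine ⟨c⁻¹, ?_⟩
  rw [eq_inv_smul_iff, ← LinearMap.map_smul_of_tower, ← hc, ← Module.End.mul_apply, ← map_mul,
    inv_mul_cancel, map_one, Module.End.one_apply]

theorem MapsLine.conj {g h : Sp ℓ} {x x' y y' : Bool × ℕ} (hg : MapsLine g x y)
    (hx : MapsLine h x x') (hy : MapsLine h y y') : MapsLine (h * g * h⁻¹) x' y' :=
  (hy.mul hg).mul hx.inv

theorem mapsLine_of_le {k : ℕ} (g : Sp ℓ) (hk : ℓ ≤ k) (b : Bool) : MapsLine g (b, k) (b, k) :=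
  ⟨1, by simp [basisVec_of_le hk]⟩

theorem mapsLine_of_mem_torus {a : Sp ℓ} (ha : a ∈ torus ℓ) (x : Bool × ℕ) : MapsLine a x x := by
  obtain ⟨t, rfl⟩ := exists_eq_torusElt_of_mem_torus ha
  obtain ⟨b, k⟩ := x
  rcases lt_or_ge k ℓ with hk | hk
  · refine ⟨if b then (t ⟨k, hk⟩)⁻¹ else t ⟨k, hk⟩, ?_⟩
    rw [stdRep_apply, coe_torusElt]
    cases b <;> ext (j | j) <;> obtain rfl | hj := eq_or_ne (j : ℕ) k <;>
      simp [basisVec, Matrix.mulVec_diagonal, *, Units.smul_def]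
  · exact mapsLine_of_le _ hk b

theorem stdRep_permElt (τ : Equiv.Perm (Fin ℓ)) (v w : Fin ℓ → ℂ) :
    stdRep (Fin ℓ) ℂ (permElt τ) (Sum.elim v w) = Sum.elim (v ∘ τ) (w ∘ τ) := by
  have half (u : Fin ℓ → ℂ) : τ.permMatrix ℂ *ᵥ u = u ∘ τ := by
    ext i
    simp [Matrix.mulVec, dotProduct, Equiv.Perm.permMatrix, PEquiv.toMatrix_apply]
  simp [stdRep_apply, permElt, Matrix.fromBlocks_mulVec, half, Function.comp_def]

theorem mapsLine_permElt (τ : Equiv.Perm (Fin ℓ)) (b : Bool) (k : Fin ℓ) :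
    MapsLine (permElt τ) (b, (τ k : ℕ)) (b, (k : ℕ)) := by
  refine ⟨1, ?_⟩
  cases b <;> simp only [basisVec, stdRep_permElt] <;> ext (j | j) <;> simp [← Fin.ext_iff]

theorem mapsLine_sElt_succ {k : ℕ} (hk : k + 1 < ℓ) (b : Bool) :
    MapsLine (sElt ℓ k) (b, k + 1) (b, k) := by
  simpa [sElt, adjSwap, hk] using mapsLine_permElt (adjSwap ℓ k) b ⟨k, by lia⟩

theorem sElt_inv (k : ℕ) : (sElt ℓ k)⁻¹ = sElt ℓ k := by
  have involutive : adjSwap ℓ k * adjSwap ℓ k = 1 := by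
    rw [adjSwap]
    split_ifs <;> simp
  rw [inv_eq_iff_mul_eq_one]
  ext1
  simp [sElt, permElt, Matrix.fromBlocks_multiply, ← Matrix.permMatrix_mul, involutive]

theorem mapsLine_sElt {k : ℕ} (hk : k + 1 < ℓ) (b : Bool) :
    MapsLine (sElt ℓ k) (b, k) (b, k + 1) :=
  sElt_inv (ℓ := ℓ) k ▸ (mapsLine_sElt_succ hk b).inv

theorem mapsLine_sElt_of_ne {k j : ℕ} (hk : j ≠ k) (hk' : j ≠ k + 1) (b : Bool) :
    MapsLine (sElt ℓ k) (b, j) (b, j) := by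
  rcases lt_or_ge j ℓ with hj | hj
  · have fixed : adjSwap ℓ k ⟨j, hj⟩ = ⟨j, hj⟩ := by
      rw [adjSwap]
      split_ifs
      · exact Equiv.swap_apply_of_ne_of_ne (by simpa using hk) (by simpa using hk')
      · rfl
    simpa [sElt, fixed] using mapsLine_permElt (adjSwap ℓ k) b ⟨j, hj⟩
  · exact mapsLine_of_le _ hj b

theorem mapsLine_tLast {k : ℕ} (hk : k + 1 = ℓ) (b : Bool) :
    MapsLine (tLast ℓ) (b, k) (!b, k) := by
  refine ⟨if b then 1 else -1, ?_⟩
  cases b <;> ext (j | j) <;> by_cases hj : (j : ℕ) = k <;>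
    simp [basisVec, stdRep_apply, tLast, Matrix.fromBlocks_mulVec, Matrix.mulVec_diagonal, hj, hk,
      -Matrix.fromBlocks_diagonal]

theorem mapsLine_tLast_of_ne {k : ℕ} (hk : k + 1 ≠ ℓ) (b : Bool) :
    MapsLine (tLast ℓ) (b, k) (b, k) := by
  refine ⟨1, ?_⟩
  cases b <;> ext (j | j) <;> by_cases hj : (j : ℕ) = k <;>
    simp [basisVec, stdRep_apply, tLast, Matrix.fromBlocks_mulVec, Matrix.mulVec_diagonal, hj, hk,
      -Matrix.fromBlocks_diagonal]

theorem prod_sRun_succ (o r : ℕ) :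
    (sRun ℓ o (r + 1)).prod = sElt ℓ o * (sRun ℓ (o + 1) r).prod := by
  simp [sRun, List.range'_succ]

theorem mapsLine_sRun_last (b : Bool) {o r : ℕ} (hr : o + r < ℓ) :
    MapsLine (sRun ℓ o r).prod (b, o + r) (b, o) := by
  induction r generalizing o with
  | zero => simpa [sRun] using mapsLine_one _
  | succ r ih =>
    rw [prod_sRun_succ, ← add_assoc, add_right_comm]
    exact (mapsLine_sElt_succ (by lia) b).mul (ih (by lia))

theorem mapsLine_sRun_of_notMem (b : Bool) {o r j : ℕ} (hj : j < o ∨ o + r < j) :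
    MapsLine (sRun ℓ o r).prod (b, j) (b, j) := by
  induction r generalizing o with
  | zero => simpa [sRun] using mapsLine_one _
  | succ r ih =>
    rw [prod_sRun_succ]
    exact (mapsLine_sElt_of_ne (by lia) (by lia) b).mul (ih (by lia))

theorem mapsLine_sRun (b : Bool) {o r j : ℕ} (hr : o + r < ℓ) (hoj : o ≤ j) (hj : j < o + r) :
    MapsLine (sRun ℓ o r).prod (b, j) (b, j + 1) := by
  induction r generalizing o with
  | zero => lia
  | succ r ih =>
    rw [prod_sRun_succ]
    rcases eq_or_lt_of_le hoj with rfl | hoj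
    · exact (mapsLine_sElt (by lia) b).mul (mapsLine_sRun_of_notMem b (by lia))
    · exact (mapsLine_sElt_of_ne (by lia) (by lia) b).mul (ih (by lia) hoj (by lia))

theorem tElt_eq_conj (k : ℕ) :
    tElt ℓ k = (sRun ℓ k (ℓ - 1 - k)).prod * tLast ℓ * (sRun ℓ k (ℓ - 1 - k)).prod⁻¹ := by
  simp [tElt, List.prod_inv_reverse, sRun, Function.comp_def, sElt_inv]

theorem mapsLine_tElt {k : ℕ} (hk : k < ℓ) (b : Bool) : MapsLine (tElt ℓ k) (b, k) (!b, k) := by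
  rw [tElt_eq_conj]
  exact (mapsLine_tLast (by lia) b).conj (mapsLine_sRun_last b (by lia))
    (mapsLine_sRun_last (!b) (by lia))

theorem mapsLine_tElt_of_ne {k j : ℕ} (hk : k < ℓ) (hj : j ≠ k) (b : Bool) :
    MapsLine (tElt ℓ k) (b, j) (b, j) := by
  rcases lt_or_ge j ℓ with hjℓ | hjℓ
  · obtain ⟨i, hi, hij⟩ : ∃ i, i + 1 ≠ ℓ ∧
        MapsLine (sRun ℓ k (ℓ - 1 - k)).prod (b, i) (b, j) := by
      rcases lt_or_gt_of_ne hj with hjk | hjk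
      · exact ⟨j, by lia, mapsLine_sRun_of_notMem b (.inl hjk)⟩
      · obtain ⟨i, rfl⟩ := Nat.exists_eq_succ_of_ne_zero (Nat.ne_zero_of_lt hjk)
        exact ⟨i, by lia, mapsLine_sRun b (by lia) (by lia) (by lia)⟩
    rw [tElt_eq_conj]
    exact (mapsLine_tLast_of_ne hi b).conj hij hij
  · exact mapsLine_of_le _ hjℓ b

end MapsLine

section NegativeCycles

variable {ℓ : ℕ} {g : Sp ℓ} {o r : ℕ}

/-- `g` permutes the lines of the basis vectors with (0-based) indices in `[o, o + r)` in a
negative cycle: `e_o ↦ e_{o+1} ↦ ⋯ ↦ e_{o+r-1} ↦ e_o'`, where `e_o'` is paired with `e_o`. -/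
structure IsNegCycle (g : Sp ℓ) (o r : ℕ) : Prop where
  pos : 0 < r
  le : o + r ≤ ℓ
  shift : ∀ b j, o ≤ j → j + 1 < o + r → MapsLine g (b, j) (b, j + 1)
  last : ∀ b, MapsLine g (b, o + r - 1) (!b, o)

theorem IsNegCycle.mul_left (hg : IsNegCycle g o r) {h : Sp ℓ}
    (hh : ∀ b j, o ≤ j → j < o + r → MapsLine h (b, j) (b, j)) : IsNegCycle (h * g) o r where
  pos := hg.pos
  le := hg.le
  shift b j hoj hj := (hh b _ (by lia) hj).mul (hg.shift b j hoj hj)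
  last b := (hh _ _ le_rfl (by grind [hg.pos])).mul (hg.last b)

theorem IsNegCycle.mul_right (hg : IsNegCycle g o r) {h : Sp ℓ}
    (hh : ∀ b j, o ≤ j → j < o + r → MapsLine h (b, j) (b, j)) : IsNegCycle (g * h) o r where
  pos := hg.pos
  le := hg.le
  shift b j hoj hj := (hg.shift b j hoj hj).mul (hh b j hoj (by lia))
  last b := (hg.last b).mul (hh b _ (by grind [hg.pos]) (by grind [hg.pos]))

theorem isNegCycle_cycleElt (hr : 0 < r) (hor : o + r ≤ ℓ) : IsNegCycle (cycleElt ℓ o r) o r where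
  pos := hr
  le := hor
  shift b _ hoj hj := (mapsLine_sRun b (by lia) hoj (by lia)).mul
    (mapsLine_tElt_of_ne (by lia) (by lia) b)
  last b := by
    have last : o + (r - 1) = o + r - 1 := by lia
    exact (last ▸ mapsLine_sRun_last (!b) (by lia)).mul (mapsLine_tElt (by lia) b)

theorem mapsLine_cycleElt_of_notMem (hr : 0 < r) (hor : o + r ≤ ℓ) {j : ℕ}
    (hj : j < o ∨ o + r ≤ j) (b : Bool) : MapsLine (cycleElt ℓ o r) (b, j) (b, j) :=
  (mapsLine_sRun_of_notMem b (by lia)).mul (mapsLine_tElt_of_ne (by lia) (by lia) b)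

theorem mapsLine_partsElt_of_lt (b : Bool) {L : List ℕ} (hL : ∀ r ∈ L, 0 < r) {j : ℕ}
    (ho : o + L.sum ≤ ℓ) (hj : j < o) : MapsLine (partsElt ℓ o L) (b, j) (b, j) := by
  induction L generalizing o with
  | nil => exact mapsLine_one _
  | cons r L ih =>
    rw [List.forall_mem_cons] at hL
    rw [List.sum_cons] at ho
    exact (mapsLine_cycleElt_of_notMem hL.1 (by lia) (.inl hj) b).mul
      (ih hL.2 (by lia) (by lia))

theorem isNegCycle_partsElt {L : List ℕ} (hL : ∀ r ∈ L, 0 < r) (ho : o + L.sum ≤ ℓ) {i : ℕ}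
    (hi : i < L.length) : IsNegCycle (partsElt ℓ o L) (o + (L.take i).sum) L[i] := by
  induction L generalizing o i with
  | nil => exact absurd hi (Nat.not_lt_zero i)
  | cons r L ih =>
    rw [List.forall_mem_cons] at hL
    rw [List.sum_cons] at ho
    cases i with
    | zero => exact (isNegCycle_cycleElt hL.1 (by lia)).mul_right fun b j _ hj =>
        mapsLine_partsElt_of_lt b hL.2 (by lia) hj
    | succ i =>
      rw [List.take_succ_cons, List.sum_cons, ← add_assoc]
      exact (ih hL.2 (by lia) (Nat.lt_of_succ_lt_succ hi)).mul_left fun b j hj _ =>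
        mapsLine_cycleElt_of_notMem hL.1 (by lia) (.inr (by lia)) b

theorem IsNegCycle.mapsLine_pow (hg : IsNegCycle g o r) (b : Bool) {j : ℕ} (hj : j < r) :
    MapsLine (g ^ j) (b, o) (b, o + j) := by
  induction j with
  | zero => exact mapsLine_one _
  | succ j ih =>
    rw [pow_succ']
    exact (hg.shift b (o + j) (by lia) (by lia)).mul (ih (by lia))

theorem IsNegCycle.mapsLine_pow_length (hg : IsNegCycle g o r) (b : Bool) :
    MapsLine (g ^ r) (b, o) (!b, o) := by
  obtain ⟨s, rfl⟩ := Nat.exists_eq_succ_of_ne_zero hg.pos.ne'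
  rw [pow_succ']
  exact (hg.last b).mul (hg.mapsLine_pow b (by lia))

theorem IsNegCycle.exists_mapsLine_pow (hg : IsNegCycle g o r) {j : ℕ} (hj : j < 2 * r) :
    ∃ b k, k < r ∧ (k = 0 → b = true → j = r) ∧ MapsLine (g ^ j) (false, o) (b, o + k) := by
  rcases lt_or_ge j r with hjr | hjr
  · exact ⟨false, j, hjr, by simp, hg.mapsLine_pow _ hjr⟩
  · obtain ⟨k, rfl⟩ := Nat.exists_eq_add_of_le' hjr
    refine ⟨true, k, by lia, by simp, ?_⟩
    rw [pow_add]
    exact (hg.mapsLine_pow true (by lia)).mul (hg.mapsLine_pow_length false)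

theorem IsNegCycle.stdForm_eq_zero_of_notMem (hg : IsNegCycle g o r) {i : ℕ}
    (hi : i < o ∨ o + r ≤ i) {j : ℕ} (hj : j < 2 * r) :
    stdForm (Fin ℓ) ℂ (basisVec ℓ (false, i))
      ((stdRep (Fin ℓ) ℂ g ^ j) (basisVec ℓ (false, o))) = 0 := by
  obtain ⟨b, k, hk, -, c, hc⟩ := hg.exists_mapsLine_pow hj
  rw [← map_pow, hc, LinearMap.map_smul_of_tower, stdForm_basisVec_of_ne _ _ (by lia), smul_zero]

theorem IsNegCycle.isNegOrbit (hg : IsNegCycle g o r) :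
    IsNegOrbit (stdForm (Fin ℓ) ℂ) (stdRep (Fin ℓ) ℂ g) r (basisVec ℓ (false, o)) := by
  have form_ne_zero : stdForm (Fin ℓ) ℂ (basisVec ℓ (false, o))
      ((stdRep (Fin ℓ) ℂ g ^ r) (basisVec ℓ (false, o))) ≠ 0 := by
    obtain ⟨c, hc⟩ := hg.mapsLine_pow_length false
    rw [← map_pow, hc, LinearMap.map_smul_of_tower, Bool.not_false,
      stdForm_basisVec_paired (by grind [hg.pos, hg.le])]
    simp [Units.smul_def]
  refine ⟨?_, fun j hj hjr => ?_, form_ne_zero⟩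
  · obtain ⟨d, hd⟩ := (hg.mapsLine_pow_length true).mul (hg.mapsLine_pow_length false)
    rw [← pow_add, ← two_mul, map_pow] at hd
    exact pow_two_mul_apply_eq_neg isAlt_stdForm (isOrthogonal_stdRep g) hd form_ne_zero
  · obtain ⟨b, k, -, hk, c, hc⟩ := hg.exists_mapsLine_pow hj
    rw [← map_pow, hc, LinearMap.map_smul_of_tower]
    rcases Nat.eq_zero_or_pos k with rfl | hk_pos
    · cases b
      · rw [add_zero, stdForm_basisVec_same_half, smul_zero]
      · exact absurd (hk rfl rfl) hjr
    · rw [stdForm_basisVec_of_ne _ _ (by lia), smul_zero]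

end NegativeCycles

section Exponential

/-- The character `x ↦ e^{2πix}` of `ℝ`, with values in the units of `ℂ`. -/
def expUnit : AddChar ℝ ℂˣ where
  toFun x := Units.mk0 (Complex.exp (2 * Real.pi * Complex.I * x)) (Complex.exp_ne_zero _)
  map_zero_eq_one' := by ext; simp
  map_add_eq_mul' x y := by ext; simp [mul_add, Complex.exp_add]

theorem coe_expUnit (x : ℝ) : (expUnit x : ℂ) = Complex.exp (2 * Real.pi * Complex.I * x) := rfl

theorem expUnit_eq_one_iff {x : ℝ} : expUnit x = 1 ↔ ∃ k : ℤ, x = k := by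
  rw [← Units.val_eq_one, coe_expUnit, Complex.exp_eq_one_iff]
  refine exists_congr fun k => ?_
  rw [mul_comm (k : ℂ), mul_right_inj' Complex.two_pi_I_ne_zero]
  norm_cast

theorem re_expUnit (x : ℝ) : (expUnit x : ℂ).re = Real.cos (2 * Real.pi * x) := by
  rw [coe_expUnit, ← Complex.exp_ofReal_mul_I_re]
  push_cast
  ring_nf

theorem isPrimitiveRoot_expUnit_inv_zpow {n : ℕ} (hn : n ≠ 0) {k : ℤ} (hk : IsCoprime k n) :
    IsPrimitiveRoot (expUnit (n : ℝ)⁻¹ ^ k) n := by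
  rw [← IsPrimitiveRoot.coe_units_iff, ← AddChar.map_zsmul_eq_zpow, coe_expUnit]
  convert Complex.isPrimitiveRoot_exp_of_isCoprime k n hn hk using 3
  simp [div_eq_mul_inv]

theorem expUnit_inv_zpow_pow (n : ℕ) (k : ℤ) (j : ℕ) :
    (expUnit (n : ℝ)⁻¹ ^ k) ^ j = expUnit (j / n) ^ k := by
  rw [← zpow_natCast, zpow_comm, zpow_natCast, ← AddChar.map_nsmul_eq_pow, nsmul_eq_mul,
    div_eq_mul_inv]

theorem exists_isCoprime_cpow_eq_expUnit {ξ : ℂˣ} {M : ℕ} (hM : M ≠ 0)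
    (hξ : IsPrimitiveRoot ξ M) :
    ∃ k : ℤ, IsCoprime k M ∧ ∀ x : ℝ, (ξ : ℂ) ^ ((M * x : ℝ) : ℂ) = expUnit x ^ k := by
  obtain ⟨i, -, hi, hexp⟩ :=
    (Complex.isPrimitiveRoot_iff _ M hM).1 (IsPrimitiveRoot.coe_units_iff.2 hξ)
  obtain ⟨t, ht⟩ := Complex.log_exp_exists (2 * Real.pi * Complex.I * (i / M))
  refine ⟨i + t * M, (Nat.isCoprime_iff_coprime.2 hi).add_mul_right_left t, fun x => ?_⟩
  have hM' : (M : ℂ) ≠ 0 := mod_cast hM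
  rw [Complex.cpow_def_of_ne_zero ξ.ne_zero, ← hexp, ht, ← Units.val_zpow_eq_zpow_val,
    ← AddChar.map_zsmul_eq_zpow, coe_expUnit]
  congr 1
  push_cast [zsmul_eq_mul]
  field_simp

variable {ℓ : ℕ}

theorem torusElt_one : torusElt (1 : Fin ℓ → ℂˣ) = 1 := by
  ext1
  simp [torusElt]

theorem torusElt_mul (a b : Fin ℓ → ℂˣ) : torusElt (a * b) = torusElt a * torusElt b := by
  ext1
  simp [coe_torusElt, mul_comm]

variable (ℓ) in
/-- The exponential map `V → A` that sends `x` to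
`Diag(e^{2πix₁}, …, e^{2πix_ℓ}, e^{-2πix_ℓ}, …, e^{-2πix₁})`. -/
def torusExp : AddChar (Fin ℓ → ℝ) (Sp ℓ) where
  toFun x := torusElt fun j => expUnit (x j)
  map_zero_eq_one' := by
    simp only [Pi.zero_apply, AddChar.map_zero_eq_one]
    exact torusElt_one
  map_add_eq_mul' x y := by
    simp only [Pi.add_apply, AddChar.map_add_eq_mul]
    exact torusElt_mul _ _

theorem torusExp_apply (x : Fin ℓ → ℝ) : torusExp ℓ x = torusElt fun j => expUnit (x j) := rfl

theorem torusExp_zpow (x : Fin ℓ → ℝ) (k : ℤ) :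
    torusExp ℓ x ^ k = torusElt fun j => expUnit (x j) ^ k := by
  rw [← AddChar.map_zsmul_eq_zpow, torusExp_apply]
  simp only [← AddChar.map_zsmul_eq_zpow, Pi.smul_apply]

variable {G : Type*} [Group G] {π : Sp ℓ →* G}

theorem isCocharacter_iff {v : Fin ℓ → ℝ} : IsCocharacter π v ↔ π (torusExp ℓ v) = 1 := Iff.rfl

theorem exists_isCoprime_cocharValue_eq {ξ : ℂˣ} {M : ℕ} (hM : M ≠ 0) (hξ : IsPrimitiveRoot ξ M) :
    ∃ k : ℤ, IsCoprime k M ∧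
      ∀ x : Fin ℓ → ℝ, cocharValue π ((M : ℝ) • x) ξ = π (torusExp ℓ x ^ k) := by
  obtain ⟨k, hk, hpow⟩ := exists_isCoprime_cpow_eq_expUnit hM hξ
  refine ⟨k, hk, fun x => ?_⟩
  rw [torusExp_zpow, cocharValue]
  congr 2
  ext j
  simp [← hpow]

end Exponential

section Cells

variable {ℓ : ℕ}

/-- The cells of a composition: the pairs of a block and a position in that block. -/
abbrev Cell (c : Composition ℓ) : Type := Σ i : Fin c.length, Fin (c.blocksFun i)

/-- The number `(2a - 1)/(4r)` attached to the `a`-th cell of a block of length `r`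
(`x.2 = a - 1`). -/
def cellAngle (c : Composition ℓ) (x : Cell c) : ℝ :=
  (2 * x.2 + 1 : ℕ) / (4 * c.blocksFun x.1 : ℕ)

theorem cellAngle_mem_Ioo (c : Composition ℓ) (x : Cell c) : cellAngle c x ∈ Set.Ioo 0 (1 / 2) := by
  have hlt : 2 * (2 * (x.2 : ℕ) + 1) < 4 * c.blocksFun x.1 := by have := x.2.2; lia
  have hpos : (0 : ℝ) < (4 * c.blocksFun x.1 : ℕ) := by
    have := x.2.2
    exact_mod_cast (by lia : 0 < 4 * c.blocksFun x.1)
  refine ⟨by rw [cellAngle]; positivity, ?_⟩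
  rw [cellAngle, div_lt_div_iff₀ hpos two_pos, one_mul]
  exact_mod_cast mul_comm 2 (2 * (x.2 : ℕ) + 1) ▸ hlt

theorem isNegCycle_partsElt_mul (c : Composition ℓ) {a : Sp ℓ} (ha : a ∈ torus ℓ)
    (i : Fin c.length) :
    IsNegCycle (partsElt ℓ 0 c.blocks * a) (c.sizeUpTo i) (c.blocksFun i) := by
  have cycle := isNegCycle_partsElt (o := 0) (fun r hr => c.blocks_pos hr)
    (by rw [zero_add, c.blocks_sum]) i.2
  rw [zero_add] at cycle
  exact cycle.mul_right fun b j _ _ => mapsLine_of_mem_torus ha _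

theorem sizeUpTo_lt_or_le_of_ne (c : Composition ℓ) {i j : Fin c.length} (hij : i ≠ j) :
    c.sizeUpTo i < c.sizeUpTo j ∨ c.sizeUpTo j + c.blocksFun j ≤ c.sizeUpTo i := by
  rcases hij.lt_or_gt with h | h
  · have := c.monotone_sizeUpTo (Nat.succ_le_of_lt h)
    have := c.sizeUpTo_succ' i
    have := c.one_le_blocksFun i
    left; lia
  · right
    rw [← c.sizeUpTo_succ' j]
    exact c.monotone_sizeUpTo h

theorem odd_pow_pow_eq_neg_one {R : Type*} [CommRing R] [IsDomain R] {ζ : Rˣ} {r : ℕ} (hr : r ≠ 0)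
    (hζ : IsPrimitiveRoot ζ (4 * r)) (a : ℕ) : (ζ ^ (2 * a + 1)) ^ (2 * r) = -1 := by
  have order_two : IsPrimitiveRoot (ζ ^ (2 * r)) 2 := hζ.pow (by lia) (by lia)
  have half_turn : ζ ^ (2 * r) = -1 :=
    Units.ext (IsPrimitiveRoot.coe_units_iff.2 order_two).eq_neg_one_of_two_right
  rw [pow_right_comm, half_turn, (odd_two_mul_add_one a).neg_one_pow]

theorem isConj_partsElt_mul_torusExp_zpow (c : Composition ℓ) {a : Sp ℓ} (ha : a ∈ torus ℓ)
    {x : Fin ℓ → ℝ} (e : Fin ℓ ≃ Cell c) (hx : ∀ j, x j = cellAngle c (e j))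
    {k : ℤ} (hk : ∀ i, IsCoprime k (4 * c.blocksFun i : ℕ)) :
    IsConj (partsElt ℓ 0 c.blocks * a) (torusExp ℓ x ^ k) := by
  have hr (i) : c.blocksFun i ≠ 0 := Nat.one_le_iff_ne_zero.1 (c.one_le_blocksFun i)
  set ζ : Fin c.length → ℂˣ := fun i => expUnit ((4 * c.blocksFun i : ℕ) : ℝ)⁻¹ ^ k
  have hζ (i) : IsPrimitiveRoot (ζ i) (4 * c.blocksFun i) :=
    isPrimitiveRoot_expUnit_inv_zpow (by have := hr i; lia) (hk i)
  have eigenvalue (j) : expUnit (x j) ^ k = ζ (e j).1 ^ (2 * ((e j).2 : ℕ) + 1) := by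
    rw [hx, cellAngle, expUnit_inv_zpow_pow]
  have cycle := isNegCycle_partsElt_mul c ha
  rw [torusExp_zpow]
  simp only [eigenvalue]
  refine isConj_torusElt_of_isNegOrbit hr (fun i => (cycle i).isNegOrbit)
    (fun i i' hi j hj => (cycle i').stdForm_eq_zero_of_notMem (sizeUpTo_lt_or_le_of_ne c hi) hj)
    (fun j => (e j).1) (fun j => ?_) (fun j j' hj => ?_) fun j j' hj h => e.injective ?_
  · exact odd_pow_pow_eq_neg_one (hr _) (hζ _) _
  · generalize e j = y, e j' = y' at hj
    obtain ⟨i, a⟩ := y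
    obtain ⟨i', b⟩ := y'
    obtain rfl : i = i' := hj
    rw [← pow_add]
    exact (hζ i).pow_ne_one_of_pos_of_lt (by lia) (by lia)
  · generalize e j = y, e j' = y' at hj h
    obtain ⟨i, a⟩ := y
    obtain ⟨i', b⟩ := y'
    obtain rfl : i = i' := hj
    have := (hζ i).pow_inj (by lia) (by lia) h
    exact congrArg _ (Fin.ext (by lia))

end Cells

section SigmaPoint

variable {ℓ : ℕ}

/-- The parts of a partition in increasing order, as a composition. -/
def sortedComposition (p : ℓ.Partition) : Composition ℓ where
  blocks := p.parts.sort (· ≤ ·)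
  blocks_pos h := p.parts_pos ((Multiset.mem_sort _).1 h)
  blocks_sum := by rw [← Multiset.sum_coe, Multiset.sort_eq, p.parts_sum]

theorem map_blocksFun_sortedComposition (p : ℓ.Partition) :
    Finset.univ.val.map (sortedComposition p).blocksFun = p.parts := by
  rw [Fin.univ_val_map, Composition.ofFn_blocksFun, sortedComposition, Multiset.sort_eq]

theorem blocksFun_sortedComposition_mem_parts (p : ℓ.Partition)
    (i : Fin (sortedComposition p).length) : (sortedComposition p).blocksFun i ∈ p.parts :=
  (Multiset.mem_sort _).1 ((sortedComposition p).blocksFun_mem_blocks i)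

theorem bigM_ne_zero (p : ℓ.Partition) : bigM p ≠ 0 :=
  mul_ne_zero four_ne_zero fun h => (p.parts_pos (Multiset.lcm_eq_zero_iff _ |>.1 h)).false

theorem four_mul_dvd_bigM {p : ℓ.Partition} {r : ℕ} (hr : r ∈ p.parts) : 4 * r ∣ bigM p :=
  mul_dvd_mul_left 4 (Multiset.dvd_lcm hr)

theorem map_Icc_one_eq_map_univ {α : Type*} (r : ℕ) (f : ℕ → α) :
    (Finset.Icc 1 r).val.map f =
      (Finset.univ : Finset (Fin r)).val.map fun a : Fin r => f (a + 1) := by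
  have Icc_eq : (Finset.Icc 1 r).val = (List.range r).map (1 + ·) := by
    rw [← List.range'_eq_map_range]
    rfl
  rw [Icc_eq, Fin.univ_val_map, Multiset.map_coe, List.map_map, List.ofFn_eq_map,
    ← List.map_coe_finRange_eq_range, List.map_map]
  simp [Function.comp_def, add_comm]

theorem map_sigmaList_div_bigM (p : ℓ.Partition) :
    (sigmaList p : Multiset ℕ).map (fun s : ℕ => (s / bigM p : ℝ)) =
      Finset.univ.val.map (cellAngle (sortedComposition p)) := by
  have angle {r : ℕ} (hr : r ∈ p.parts) (a : ℕ) :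
      (((2 * (a + 1) - 1) * bigM p / (4 * r) : ℕ) / bigM p : ℝ) =
        (2 * a + 1 : ℕ) / (4 * r : ℕ) := by
    have hm : (bigM p : ℝ) ≠ 0 := mod_cast bigM_ne_zero p
    have hr' : ((4 * r : ℕ) : ℝ) ≠ 0 := mod_cast mul_ne_zero four_ne_zero (p.parts_pos hr).ne'
    rw [Nat.cast_div ((four_mul_dvd_bigM hr).mul_left _) hr', Nat.cast_mul, div_right_comm,
      mul_div_cancel_right₀ _ hm]
    rfl
  have univ_cell : (Finset.univ : Finset (Cell (sortedComposition p))).val =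
      Finset.univ.val.bind fun i => Finset.univ.val.map (Sigma.mk i) := rfl
  rw [sigmaList, Multiset.sort_eq, Multiset.map_bind, univ_cell, Multiset.map_bind]
  conv_lhs => rw [← map_blocksFun_sortedComposition, Multiset.bind_map]
  refine Multiset.bind_congr fun i _ => ?_
  rw [Multiset.map_map, Multiset.map_map, map_Icc_one_eq_map_univ]
  exact Multiset.map_congr rfl fun a _ => angle (blocksFun_sortedComposition_mem_parts p i) a

theorem length_sigmaList (p : ℓ.Partition) : (sigmaList p).length = ℓ := by
  have h := congrArg Multiset.card (map_sigmaList_div_bigM p)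
  rw [Multiset.card_map, Multiset.card_map, Multiset.coe_card] at h
  rw [h]
  exact (Fintype.card_congr (sortedComposition p).blocksFinEquiv).trans (Fintype.card_fin ℓ)

/-- The point `(σ₁/m, …, σ_ℓ/m)` of `V`. -/
def sigmaPoint (p : ℓ.Partition) (j : Fin ℓ) : ℝ := sigma p (j + 1) / bigM p

theorem bigM_mul_sigmaPoint (p : ℓ.Partition) (j : Fin ℓ) :
    bigM p * sigmaPoint p j = sigma p (j + 1) :=
  mul_div_cancel₀ _ (mod_cast bigM_ne_zero p)

theorem map_sigmaPoint (p : ℓ.Partition) :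
    Finset.univ.val.map (sigmaPoint p) =
      Finset.univ.val.map (cellAngle (sortedComposition p)) := by
  rw [← map_sigmaList_div_bigM, Fin.univ_val_map, Multiset.map_coe]
  congr 1
  refine List.ext_getElem (by simp [length_sigmaList]) fun i hi hi' => ?_
  rw [List.length_map] at hi'
  simp [sigmaPoint, sigma, hi']

theorem exists_equiv_of_map_univ_eq {α β γ : Type*} [Fintype α] [Fintype β] {f : α → γ} {g : β → γ}
    (h : Finset.univ.val.map f = Finset.univ.val.map g) : ∃ e : α ≃ β, ∀ a, f a = g (e a) := by
  classical
  have card_fiber (c : γ) : Fintype.card {a // f a = c} = Fintype.card {b // g b = c} := by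
    have := congrArg (Multiset.count c) h
    simp only [Multiset.count_map] at this
    simp only [Fintype.card_subtype, Finset.card_def, Finset.filter_val]
    simpa only [eq_comm (a := c)] using this
  exact ⟨Equiv.ofFiberEquiv fun c => Fintype.equivOfCardEq (card_fiber c),
    fun a => (Equiv.ofFiberEquiv_map _ a).symm⟩

theorem exists_equiv_cell (p : ℓ.Partition) :
    ∃ e : Fin ℓ ≃ Cell (sortedComposition p),
      ∀ j, sigmaPoint p j = cellAngle (sortedComposition p) (e j) :=
  exists_equiv_of_map_univ_eq (map_sigmaPoint p)

theorem sigmaPoint_mem_Ioo (p : ℓ.Partition) (j : Fin ℓ) : sigmaPoint p j ∈ Set.Ioo 0 (1 / 2) := by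
  obtain ⟨e, he⟩ := exists_equiv_cell p
  exact he j ▸ cellAngle_mem_Ioo _ _

theorem antitone_sigmaPoint (p : ℓ.Partition) : Antitone (sigmaPoint p) := by
  refine antitone_iff_forall_lt.2 fun i j hij => ?_
  have sorted : (sigmaList p)[(j : ℕ)]'(by simp [length_sigmaList]) ≤
      (sigmaList p)[(i : ℕ)]'(by simp [length_sigmaList]) :=
    List.pairwise_iff_getElem.1 (Multiset.pairwise_sort _ (· ≥ ·)) _ _ _ _ hij
  simp only [sigmaPoint, sigma]
  gcongr
  simpa [length_sigmaList] using sorted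

theorem exists_isConj_nElt_mul {p : ℓ.Partition} {n : ↥(normTorus ℓ)}
    (hn : ConjClasses.mk (toWeyl n) = ellipticClass p) :
    ∃ a ∈ torus ℓ, IsConj (n : Sp ℓ) (nElt p * a) := by
  obtain ⟨c, hc⟩ := isConj_iff.1 (ConjClasses.mk_eq_mk_iff_isConj.1 hn)
  obtain ⟨w, rfl⟩ := QuotientGroup.mk_surjective c
  have same_coset := QuotientGroup.eq.1 (hc.symm :
    ((⟨nElt p, nElt_mem p⟩ : normTorus ℓ) : Weyl ℓ) = (w * n * w⁻¹ : normTorus ℓ))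
  exact ⟨_, same_coset, isConj_iff.2 ⟨w, by simp⟩⟩

theorem exists_sigmaPoint_eq_inv {p : ℓ.Partition} {r : ℕ} (hr : r ∈ p.parts) :
    ∃ j, sigmaPoint p j = ((4 * r : ℕ) : ℝ)⁻¹ := by
  rw [← map_blocksFun_sortedComposition] at hr
  obtain ⟨i, -, rfl⟩ := Multiset.mem_map.1 hr
  obtain ⟨e, he⟩ := exists_equiv_cell p
  refine ⟨e.symm ⟨i, ⟨0, (sortedComposition p).blocks_pos' _ i.2⟩⟩, ?_⟩
  rw [he, e.apply_symm_apply, cellAngle]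
  simp

theorem isConj_torusExp_sigmaPoint_zpow {p : ℓ.Partition} {n : ↥(normTorus ℓ)}
    (hn : ConjClasses.mk (toWeyl n) = ellipticClass p) {k : ℤ} (hk : IsCoprime k (bigM p)) :
    IsConj (n : Sp ℓ) (torusExp ℓ (sigmaPoint p) ^ k) := by
  obtain ⟨a, ha, hconj⟩ := exists_isConj_nElt_mul hn
  obtain ⟨e, he⟩ := exists_equiv_cell p
  refine hconj.trans (isConj_partsElt_mul_torusExp_zpow (sortedComposition p) ha e he fun i => ?_)
  exact hk.of_isCoprime_of_dvd_right (mod_cast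
    four_mul_dvd_bigM (blocksFun_sortedComposition_mem_parts p i))

end SigmaPoint

section Alcove

variable {ℓ : ℕ}

theorem isLinearMap_simpleRoot (k : Fin ℓ) : IsLinearMap ℝ (simpleRoot k) where
  map_add v w := by
    simp only [simpleRoot, Pi.add_apply]
    split_ifs <;> ring
  map_smul c v := by
    simp only [simpleRoot, Pi.smul_apply, smul_eq_mul]
    split_ifs <;> ring

theorem simpleRoot_coweight (k j : Fin ℓ) : simpleRoot k (coweight j) = if j = k then 1 else 0 := by
  simp only [simpleRoot, coweight, Fin.le_def, Fin.ext_iff]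
  split_ifs <;> first | lia | norm_num

theorem simpleRoot_sum_smul_coweight (k : Fin ℓ) (s : Fin ℓ → ℝ) :
    simpleRoot k (∑ j, s j • coweight j) = s k := by
  change (isLinearMap_simpleRoot k).mk' _ _ = _
  simp [map_sum, simpleRoot_coweight]

theorem two_mul_eq_sum_simpleRoot (v : Fin ℓ → ℝ) (j : Fin ℓ) :
    2 * v j = ∑ k ∈ Finset.Ici j, (nodeCoeff k.succ : ℝ) * simpleRoot k v := by
  set w : ℕ → ℝ := fun i => if hi : i < ℓ then v ⟨i, hi⟩ else 0
  have telescoping (k : Fin ℓ) : (nodeCoeff k.succ : ℝ) * simpleRoot k v =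
      -2 * w (k + 1) - -2 * w k := by
    simp only [nodeCoeff, simpleRoot, w, Fin.val_succ, k.2, dif_pos]
    split_ifs <;> first | lia | (push_cast; ring)
  have sum_Ico := Finset.sum_Ico_sub (fun i => -2 * w i) j.2.le
  rw [← Fin.map_valEmbedding_Ici, Finset.sum_map] at sum_Ico
  simp only [telescoping]
  refine Eq.trans ?_ sum_Ico.symm
  simp [w]

theorem ext_simpleRoot {v w : Fin ℓ → ℝ} (h : ∀ k, simpleRoot k v = simpleRoot k w) : v = w := by
  ext j
  rw [← mul_right_inj' two_ne_zero, two_mul_eq_sum_simpleRoot, two_mul_eq_sum_simpleRoot]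
  simp only [h]

theorem highestRoot_eq [NeZero ℓ] (v : Fin ℓ → ℝ) : highestRoot v = 2 * v 0 := by
  rw [two_mul_eq_sum_simpleRoot, ← bot_eq_zero, Finset.Ici_bot, highestRoot]

theorem nodeCoeff_pos (i : Fin (ℓ + 1)) : 0 < nodeCoeff i := by
  rw [nodeCoeff]
  split_ifs <;> norm_num

theorem mem_closedAlcove_iff_antitone {v : Fin ℓ → ℝ} :
    v ∈ closedAlcove ℓ ↔ Antitone v ∧ ∀ j, v j ∈ Set.Icc 0 (1 / 2) := by
  constructor
  · rintro ⟨hroot, hhighest⟩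
    have term_nonneg (k : Fin ℓ) : 0 ≤ (nodeCoeff k.succ : ℝ) * simpleRoot k v :=
      mul_nonneg (mod_cast (nodeCoeff_pos _).le) (hroot k)
    have sum_mono {s t : Finset (Fin ℓ)} (hst : s ⊆ t) :
        ∑ k ∈ s, (nodeCoeff k.succ : ℝ) * simpleRoot k v ≤
          ∑ k ∈ t, (nodeCoeff k.succ : ℝ) * simpleRoot k v :=
      Finset.sum_le_sum_of_subset_of_nonneg hst fun k _ _ => term_nonneg k
    refine ⟨fun i j hij => ?_, fun j => ⟨?_, ?_⟩⟩
    · have := sum_mono (Finset.Ici_subset_Ici.2 hij)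
      rw [← two_mul_eq_sum_simpleRoot, ← two_mul_eq_sum_simpleRoot] at this
      linarith
    · have := sum_mono (Finset.empty_subset (Finset.Ici j))
      rw [← two_mul_eq_sum_simpleRoot, Finset.sum_empty] at this
      linarith
    · have := (sum_mono (Finset.subset_univ (Finset.Ici j))).trans hhighest
      rw [← two_mul_eq_sum_simpleRoot] at this
      linarith
  · rintro ⟨hanti, hv⟩
    refine ⟨fun k => ?_, ?_⟩
    · rw [simpleRoot]
      split_ifs with h
      · exact sub_nonneg.2 (hanti (Fin.le_def.2 (Nat.le_succ _)))
      · exact mul_nonneg zero_le_two (hv k).1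
    · rcases Nat.eq_zero_or_pos ℓ with rfl | hℓ
      · simp [highestRoot]
      · have : NeZero ℓ := ⟨hℓ.ne'⟩
        rw [highestRoot_eq]
        linarith [(hv 0).2]

theorem sigmaPoint_mem_closedAlcove (p : ℓ.Partition) : sigmaPoint p ∈ closedAlcove ℓ :=
  mem_closedAlcove_iff_antitone.2
    ⟨antitone_sigmaPoint p, fun j => Set.Ioo_subset_Icc_self (sigmaPoint_mem_Ioo p j)⟩

/-- The affine function on `V` attached to a node of the affine Dynkin diagram: `1 - α̃` at `γ_0`
and `α_k` at `γ_k`. -/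
def affineRoot (i : Fin (ℓ + 1)) (v : Fin ℓ → ℝ) : ℝ :=
  Fin.cases (1 - highestRoot v) (simpleRoot · v) i

theorem affineRoot_zero (v : Fin ℓ → ℝ) : affineRoot 0 v = 1 - highestRoot v := rfl

theorem affineRoot_succ (k : Fin ℓ) (v : Fin ℓ → ℝ) : affineRoot k.succ v = simpleRoot k v := rfl

theorem affineRoot_nonneg {v : Fin ℓ → ℝ} (hv : v ∈ closedAlcove ℓ) (i : Fin (ℓ + 1)) :
    0 ≤ affineRoot i v :=
  Fin.cases (sub_nonneg.2 hv.2) hv.1 i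

theorem kacCoordinates_iff {M : ℕ} (hM : M ≠ 0) {x : Fin ℓ → ℝ} {s : Fin (ℓ + 1) → ℤ} :
    (x = (M : ℝ)⁻¹ • ∑ k : Fin ℓ, (s k.succ : ℝ) • coweight k ∧
      (M : ℤ) = ∑ i, nodeCoeff i * s i) ↔ ∀ i, (s i : ℝ) = M * affineRoot i x := by
  have hM' : (M : ℝ) ≠ 0 := mod_cast hM
  have coordinates : x = (M : ℝ)⁻¹ • ∑ k : Fin ℓ, (s k.succ : ℝ) • coweight k ↔
      ∀ k : Fin ℓ, (s k.succ : ℝ) = M * simpleRoot k x := by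
    rw [← smul_right_inj hM', smul_inv_smul₀ hM']
    constructor
    · intro h k
      rw [← smul_eq_mul, ← (isLinearMap_simpleRoot k).map_smul, h, simpleRoot_sum_smul_coweight]
    · intro h
      refine ext_simpleRoot fun k => ?_
      rw [(isLinearMap_simpleRoot k).map_smul, simpleRoot_sum_smul_coweight, h, smul_eq_mul]
  rw [coordinates, Fin.forall_fin_succ (P := fun i => (s i : ℝ) = M * affineRoot i x), and_comm]
  refine and_congr_left fun h => ?_
  have : (∑ k : Fin ℓ, (nodeCoeff k.succ * s k.succ : ℝ)) = M * highestRoot x := by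
    rw [highestRoot, Finset.mul_sum]
    exact Finset.sum_congr rfl fun k _ => by rw [h k]; ring
  rw [Fin.sum_univ_succ, affineRoot_zero, mul_sub, mul_one, ← this, eq_sub_iff_add_eq, eq_comm]
  simp only [nodeCoeff, Fin.val_zero, true_or, if_true, one_mul]
  exact_mod_cast Iff.rfl

theorem cast_labels [NeZero ℓ] (p : ℓ.Partition) (i : Fin (ℓ + 1)) :
    (labels p i : ℝ) = bigM p * affineRoot i (sigmaPoint p) := by
  refine Fin.cases ?_ (fun k => ?_) i
  · have : (sigma p 1 : ℝ) = bigM p * sigmaPoint p 0 := (bigM_mul_sigmaPoint p 0).symm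
    rw [affineRoot_zero, highestRoot_eq, labels, Fin.val_zero, if_pos rfl]
    push_cast
    rw [this]
    ring
  · rw [affineRoot_succ, labels, simpleRoot, Fin.val_succ, if_neg (Nat.succ_ne_zero k)]
    split_ifs with h₁ h₂ h₂
    · exact absurd h₁ h₂.ne
    · have := bigM_mul_sigmaPoint p k
      rw [h₁] at this
      push_cast
      rw [← this]
      ring
    · push_cast
      rw [mul_sub, bigM_mul_sigmaPoint, bigM_mul_sigmaPoint]
    · exact absurd (Nat.lt_of_le_of_ne k.2 h₁) h₂

end Alcove

section AlcoveRigidity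

theorem charpoly_eq_of_isConj {n R : Type*} [Fintype n] [DecidableEq n] [CommRing R]
    {A B : Matrix n n R} (h : IsConj A B) : A.charpoly = B.charpoly := by
  obtain ⟨c, hc⟩ := h
  rw [← c.mul_inv_eq_iff_eq_mul.2 hc, Matrix.coe_units_inv, Matrix.charpoly_units_conj]

theorem roots_charpoly_diagonal {n R : Type*} [Fintype n] [DecidableEq n] [CommRing R] [IsDomain R]
    (d : n → R) : (Matrix.diagonal d).charpoly.roots = Finset.univ.val.map d := by
  rw [Matrix.charpoly_diagonal, ← Polynomial.roots_multiset_prod_X_sub_C (Finset.univ.val.map d),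
    Multiset.map_map]
  rfl

variable {ℓ : ℕ}

theorem map_re_roots_charpoly_torusExp (x : Fin ℓ → ℝ) :
    (torusExp ℓ x).1.charpoly.roots.map Complex.re =
      2 • Finset.univ.val.map fun j => Real.cos (2 * Real.pi * x j) := by
  have univ_sum : (Finset.univ : Finset (Fin ℓ ⊕ Fin ℓ)).val =
      Finset.univ.val.map Sum.inl + Finset.univ.val.map Sum.inr := rfl
  rw [torusExp_apply, coe_torusElt, roots_charpoly_diagonal, univ_sum, two_nsmul]
  simp only [Multiset.map_add, Multiset.map_map, Function.comp_def, Sum.elim_inl, Sum.elim_inr,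
    ← AddChar.map_neg_eq_inv, re_expUnit, mul_neg, Real.cos_neg]

theorem eq_of_monotone_of_map_univ_eq {n : ℕ} {f g : Fin n → ℝ} (hf : Monotone f) (hg : Monotone g)
    (h : Finset.univ.val.map f = Finset.univ.val.map g) : f = g := by
  rw [Fin.univ_val_map, Fin.univ_val_map, Multiset.coe_eq_coe] at h
  exact List.ofFn_injective (h.eq_of_pairwise' hf.sortedLE_ofFn.pairwise hg.sortedLE_ofFn.pairwise)

theorem eq_of_isConj_torusExp {x y : Fin ℓ → ℝ} (hx : x ∈ closedAlcove ℓ) (hy : y ∈ closedAlcove ℓ)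
    (h : IsConj (torusExp ℓ x) (torusExp ℓ y)) : x = y := by
  have angle_mem {v : Fin ℓ → ℝ} (hv : v ∈ closedAlcove ℓ) (j : Fin ℓ) :
      2 * Real.pi * v j ∈ Set.Icc 0 Real.pi := by
    obtain ⟨h0, h1⟩ := (mem_closedAlcove_iff_antitone.1 hv).2 j
    exact ⟨by positivity, by nlinarith [Real.pi_pos]⟩
  have cos_monotone {v : Fin ℓ → ℝ} (hv : v ∈ closedAlcove ℓ) :
      Monotone fun j => Real.cos (2 * Real.pi * v j) := fun i j hij =>
    Real.strictAntiOn_cos.antitoneOn (angle_mem hv j) (angle_mem hv i)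
      (by have := (mem_closedAlcove_iff_antitone.1 hv).1 hij; gcongr)
  have charpoly_eq : (torusExp ℓ x).1.charpoly = (torusExp ℓ y).1.charpoly :=
    charpoly_eq_of_isConj ((Matrix.symplecticGroup (Fin ℓ) ℂ).subtype.map_isConj h)
  have cos_eq := eq_of_monotone_of_map_univ_eq (cos_monotone hx) (cos_monotone hy) <|
    nsmul_right_injective two_ne_zero <| by
      simpa only [← map_re_roots_charpoly_torusExp] using
        congrArg (fun P => P.roots.map Complex.re) charpoly_eq
  ext j
  exact mul_left_cancel₀ Real.two_pi_pos.ne'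
    (Real.injOn_cos (angle_mem hx j) (angle_mem hy j) (congrFun cos_eq j))

end AlcoveRigidity

section Lifts

theorem orderOf_eq_of_isConj {G : Type*} [Group G] {g h : G} (H : IsConj g h) :
    orderOf g = orderOf h := by
  obtain ⟨c, rfl⟩ := isConj_iff.1 H
  exact ((MulAut.conj c).orderOf_eq g).symm

theorem isConj_of_isConj_zpow {G : Type*} [Group G] {g h : G} {N : ℕ} {k : ℤ} (hg : g ^ N = 1)
    (hh : h ^ N = 1) (hk : IsCoprime k N) (H : IsConj (g ^ k) (h ^ k)) : IsConj g h := by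
  obtain ⟨u, v, huv⟩ := hk
  obtain ⟨c, hc⟩ := isConj_iff.1 H
  have zpow_zpow_eq {y : G} (hy : y ^ N = 1) : (y ^ k) ^ u = y := by
    rw [← zpow_mul, mul_comm, eq_sub_of_add_eq huv, mul_comm, zpow_sub, zpow_mul, zpow_natCast, hy,
      one_zpow, inv_one, mul_one, zpow_one]
  refine isConj_iff.2 ⟨c, ?_⟩
  rw [← zpow_zpow_eq hg, ← zpow_zpow_eq hh, ← hc, conj_zpow]

variable {ℓ : ℕ}

theorem torusElt_injective : Function.Injective (torusElt : (Fin ℓ → ℂˣ) → Sp ℓ) := by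
  intro a b h
  ext j
  simpa [coe_torusElt] using congrArg (fun g : Sp ℓ => g.1 (Sum.inl j) (Sum.inl j)) h

theorem torusExp_eq_one_iff {x : Fin ℓ → ℝ} : torusExp ℓ x = 1 ↔ ∀ j, ∃ k : ℤ, x j = k := by
  rw [torusExp_apply, ← torusElt_one, torusElt_injective.eq_iff, funext_iff]
  exact forall_congr' fun j => expUnit_eq_one_iff

theorem bigM_dvd [NeZero ℓ] {p : ℓ.Partition} {N : ℕ} (h : ∀ r ∈ p.parts, 4 * r ∣ N) :
    bigM p ∣ N := by
  obtain ⟨r, hr⟩ : ∃ r, r ∈ p.parts := Multiset.exists_mem_of_ne_zero fun h0 =>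
    NeZero.ne ℓ <| by rw [← p.parts_sum, h0, Multiset.sum_zero]
  obtain ⟨N', rfl⟩ := dvd_of_mul_right_dvd (h r hr)
  exact Nat.mul_dvd_mul_left 4 <| Multiset.lcm_dvd.2 fun r hr =>
    Nat.dvd_of_mul_dvd_mul_left four_pos (h r hr)

theorem orderOf_torusExp_sigmaPoint [NeZero ℓ] (p : ℓ.Partition) :
    orderOf (torusExp ℓ (sigmaPoint p)) = bigM p := by
  have pow_eq_one_iff (N : ℕ) :
      torusExp ℓ (sigmaPoint p) ^ N = 1 ↔ ∀ j, ∃ k : ℤ, N * sigmaPoint p j = k := by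
    rw [← AddChar.map_nsmul_eq_pow, torusExp_eq_one_iff]
    simp only [Pi.smul_apply, nsmul_eq_mul]
  refine Nat.dvd_antisymm ?_ (bigM_dvd fun r hr => ?_)
  · exact orderOf_dvd_of_pow_eq_one ((pow_eq_one_iff _).2 fun j => ⟨_, bigM_mul_sigmaPoint p j⟩)
  · obtain ⟨j, hj⟩ := exists_sigmaPoint_eq_inv hr
    obtain ⟨k, hk⟩ := (pow_eq_one_iff _).1 (pow_orderOf_eq_one (torusExp ℓ (sigmaPoint p))) j
    have hr' : ((4 * r : ℕ) : ℝ) ≠ 0 := mod_cast mul_ne_zero four_ne_zero (p.parts_pos hr).ne'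
    rw [hj, ← div_eq_mul_inv, div_eq_iff hr'] at hk
    exact Int.natCast_dvd_natCast.1 ⟨k, by rw [mul_comm]; exact_mod_cast hk⟩

theorem orderOf_eq_bigM [NeZero ℓ] {p : ℓ.Partition} {n : ↥(normTorus ℓ)}
    (hn : ConjClasses.mk (toWeyl n) = ellipticClass p) : orderOf (n : Sp ℓ) = bigM p := by
  have h := isConj_torusExp_sigmaPoint_zpow hn isCoprime_one_left
  rw [zpow_one] at h
  rw [orderOf_eq_of_isConj h, orderOf_torusExp_sigmaPoint]

theorem isConj_mul_of_mem_torus {p : ℓ.Partition} {n : ↥(normTorus ℓ)}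
    (hn : ConjClasses.mk (toWeyl n) = ellipticClass p) {a : Sp ℓ} (ha : a ∈ torus ℓ) :
    IsConj (n : Sp ℓ) (n * a) := by
  let a' : normTorus ℓ := ⟨a, Subgroup.le_normalizer ha⟩
  have same_image : toWeyl (n * a') = toWeyl n := QuotientGroup.mk_mul_of_mem n ha
  have coprime : IsCoprime 1 (bigM p : ℤ) := isCoprime_one_left
  exact (isConj_torusExp_sigmaPoint_zpow hn coprime).trans
    (isConj_torusExp_sigmaPoint_zpow (n := n * a') (same_image ▸ hn) coprime).symm

theorem center_le_torus : Subgroup.center (Sp ℓ) ≤ torus ℓ := by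
  intro z hz
  change z.1.IsDiag
  rcases coe_eq_one_or_neg_one_of_mem_center hz with h | h <;> rw [h]
  exacts [Matrix.isDiag_one, Matrix.isDiag_one.neg]

theorem sq_eq_one_of_mem_center {z : Sp ℓ} (hz : z ∈ Subgroup.center (Sp ℓ)) : z ^ 2 = 1 := by
  ext1
  rcases coe_eq_one_or_neg_one_of_mem_center hz with h | h <;> simp [h]

variable {G : Type*} [Group G] {π : Sp ℓ →* G}

theorem isConj_of_isConj_map (hπ : Function.Surjective π)
    (hker : π.ker ≤ Subgroup.center (Sp ℓ)) {p : ℓ.Partition} {n : ↥(normTorus ℓ)}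
    (hn : ConjClasses.mk (toWeyl n) = ellipticClass p) {g : Sp ℓ} (H : IsConj (π n) (π g)) :
    IsConj (n : Sp ℓ) g := by
  obtain ⟨d, hd⟩ := isConj_iff.1 H
  obtain ⟨c, rfl⟩ := hπ d
  have hz : (n : Sp ℓ)⁻¹ * (c⁻¹ * g * c) ∈ π.ker := by
    simp only [MonoidHom.mem_ker, map_mul, map_inv, ← hd]
    group
  refine (isConj_mul_of_mem_torus hn (center_le_torus (hker hz))).trans (isConj_iff.2 ⟨c, ?_⟩)
  group

theorem pow_two_mul_eq_one (hker : π.ker ≤ Subgroup.center (Sp ℓ)) {g : Sp ℓ} {N : ℕ}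
    (hg : π g ^ N = 1) : g ^ (2 * N) = 1 := by
  rw [mul_comm, pow_mul]
  exact sq_eq_one_of_mem_center (hker (by rwa [MonoidHom.mem_ker, map_pow]))

theorem isCoprime_two_mul_orderOf_map [NeZero ℓ] (hker : π.ker ≤ Subgroup.center (Sp ℓ))
    {p : ℓ.Partition} {n : ↥(normTorus ℓ)} (hn : ConjClasses.mk (toWeyl n) = ellipticClass p)
    {k : ℤ} (hk : IsCoprime k (orderOf (π n))) :
    IsCoprime k (2 * orderOf (π n) : ℕ) ∧ IsCoprime k (bigM p) := by
  have bigM_dvd_two_mul : bigM p ∣ 2 * orderOf (π n) := by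
    rw [← orderOf_eq_bigM hn]
    exact orderOf_dvd_of_pow_eq_one (pow_two_mul_eq_one hker (pow_orderOf_eq_one _))
  have two_dvd : 2 ∣ orderOf (π n) := by
    have := (dvd_mul_right 4 p.parts.lcm).trans bigM_dvd_two_mul
    lia
  have coprime : IsCoprime k (2 * orderOf (π n) : ℕ) := by
    push_cast
    exact (hk.of_isCoprime_of_dvd_right (mod_cast two_dvd)).mul_right hk
  exact ⟨coprime, coprime.of_isCoprime_of_dvd_right (mod_cast bigM_dvd_two_mul)⟩

theorem eq_sigmaPoint_of_isConj [NeZero ℓ] (hπ : Function.Surjective π)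
    (hker : π.ker ≤ Subgroup.center (Sp ℓ)) {p : ℓ.Partition} {n : ↥(normTorus ℓ)}
    (hn : ConjClasses.mk (toWeyl n) = ellipticClass p) {k : ℤ}
    (hk : IsCoprime k (orderOf (π n))) {x : Fin ℓ → ℝ} (hx : x ∈ closedAlcove ℓ)
    (hcochar : IsCocharacter π ((orderOf (π n) : ℝ) • x))
    (hconj : IsConj (π n) (π (torusExp ℓ x ^ k))) : x = sigmaPoint p := by
  obtain ⟨coprime_two_mul, coprime_bigM⟩ := isCoprime_two_mul_orderOf_map hker hn hk
  have pow_x : torusExp ℓ x ^ (2 * orderOf (π n)) = 1 := pow_two_mul_eq_one hker <| by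
    rw [← map_pow, ← AddChar.map_nsmul_eq_pow, ← Nat.cast_smul_eq_nsmul ℝ]
    exact isCocharacter_iff.1 hcochar
  have pow_sigma : torusExp ℓ (sigmaPoint p) ^ (2 * orderOf (π n)) = 1 := by
    rw [← orderOf_dvd_iff_pow_eq_one, orderOf_torusExp_sigmaPoint, ← orderOf_eq_bigM hn]
    exact orderOf_dvd_of_pow_eq_one (pow_two_mul_eq_one hker (pow_orderOf_eq_one _))
  exact eq_of_isConj_torusExp hx (sigmaPoint_mem_closedAlcove p) <|
    isConj_of_isConj_zpow pow_x pow_sigma coprime_two_mul <|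
      (isConj_of_isConj_map hπ hker hn hconj).symm.trans
        (isConj_torusExp_sigmaPoint_zpow hn coprime_bigM)

end Lifts

section KacDiagrams

theorem removeCommonFactors_const_mul {ι : Type*} [Fintype ι] {t : ℤ} (ht : 0 < t) (s : ι → ℤ) :
    removeCommonFactors (fun i => t * s i) = removeCommonFactors s := by
  ext i
  rw [removeCommonFactors, removeCommonFactors, Finset.gcd_mul_left, Int.normalize_of_nonneg ht.le,
    Int.mul_ediv_mul_of_pos _ _ ht]

theorem removeCommonFactors_eq_of_mul_eq_mul {ι : Type*} [Fintype ι] {s t : ι → ℤ} {a b : ℤ}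
    (ha : 0 < a) (hb : 0 < b) (h : ∀ i, a * s i = b * t i) :
    removeCommonFactors s = removeCommonFactors t := by
  rw [← removeCommonFactors_const_mul ha s, funext h, removeCommonFactors_const_mul hb]

variable {ℓ : ℕ} {G : Type*} [Group G] {π : Sp ℓ →* G}

theorem isKacDiagram_iff {ξ : ℂˣ} {g : G} (hg : IsOfFinOrder g)
    (hξ : IsPrimitiveRoot ξ (orderOf g)) {d : Fin (ℓ + 1) → ℤ} :
    IsKacDiagram π ξ g d ↔ ∃ x ∈ closedAlcove ℓ, IsCocharacter π ((orderOf g : ℝ) • x) ∧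
      IsConj g (cocharValue π ((orderOf g : ℝ) • x) ξ) ∧ ∃ s : Fin (ℓ + 1) → ℤ,
        (∀ i, (s i : ℝ) = orderOf g * affineRoot i x) ∧ d = removeCommonFactors s := by
  have hM : (orderOf g : ℝ) ≠ 0 := mod_cast hg.orderOf_pos.ne'
  constructor
  · rintro ⟨-, -, v, s, hcochar, hconj, hv, -, hcoord, hsum, rfl⟩
    refine ⟨(orderOf g : ℝ)⁻¹ • v, hv, ?_, ?_, s,
      (kacCoordinates_iff hg.orderOf_pos.ne').1 ⟨hcoord, hsum⟩, rfl⟩ <;>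
    rwa [smul_inv_smul₀ hM]
  · rintro ⟨x, hx, hcochar, hconj, s, hs, rfl⟩
    obtain ⟨hcoord, hsum⟩ := (kacCoordinates_iff hg.orderOf_pos.ne').2 hs
    have s_nonneg (i : Fin (ℓ + 1)) : 0 ≤ s i := by
      have : 0 ≤ orderOf g * affineRoot i x :=
        mul_nonneg (Nat.cast_nonneg _) (affineRoot_nonneg hx i)
      rw [← hs] at this
      exact_mod_cast this
    exact ⟨hg, hξ, (orderOf g : ℝ) • x, s, hcochar, hconj, by rwa [inv_smul_smul₀ hM], s_nonneg,
      by rwa [inv_smul_smul₀ hM], hsum, rfl⟩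

theorem exists_simpleRoot_eq_of_torusExp_mem_center {v : Fin ℓ → ℝ}
    (hv : torusExp ℓ v ∈ Subgroup.center (Sp ℓ)) (k : Fin ℓ) : ∃ j : ℤ, simpleRoot k v = j := by
  obtain ⟨ε, hε, expUnit_eq⟩ : ∃ ε : ℂˣ, ε * ε = 1 ∧ ∀ j, expUnit (v j) = ε := by
    have entry (j : Fin ℓ) : (expUnit (v j) : ℂ) = (torusExp ℓ v).1 (Sum.inl j) (Sum.inl j) := by
      simp [torusExp_apply, coe_torusElt]
    rcases coe_eq_one_or_neg_one_of_mem_center hv with h | h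
    · exact ⟨1, one_mul 1, fun j => Units.ext (by simp [entry, h])⟩
    · exact ⟨-1, by norm_num, fun j => Units.ext (by simp [entry, h])⟩
  rw [← expUnit_eq_one_iff, simpleRoot]
  split_ifs
  · rw [AddChar.map_sub_eq_div, expUnit_eq, expUnit_eq, div_self']
  · rw [two_mul, AddChar.map_add_eq_mul, expUnit_eq, hε]

theorem exists_mul_affineRoot_eq {M : ℕ} {x : Fin ℓ → ℝ}
    (hker : π.ker ≤ Subgroup.center (Sp ℓ)) (hx : IsCocharacter π ((M : ℝ) • x))
    (i : Fin (ℓ + 1)) : ∃ s : ℤ, (s : ℝ) = M * affineRoot i x := by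
  have root_int (k : Fin ℓ) : ∃ s : ℤ, (s : ℝ) = M * simpleRoot k x := by
    obtain ⟨s, hs⟩ := exists_simpleRoot_eq_of_torusExp_mem_center (hker (isCocharacter_iff.1 hx)) k
    exact ⟨s, by rw [← hs, (isLinearMap_simpleRoot k).map_smul, smul_eq_mul]⟩
  choose s hs using root_int
  refine Fin.cases ⟨M - ∑ k, nodeCoeff k.succ * s k, ?_⟩ (fun k => ⟨s k, hs k⟩) i
  push_cast
  rw [affineRoot_zero, highestRoot, mul_sub, mul_one, Finset.mul_sum]
  simp only [hs, mul_left_comm]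

theorem removeCommonFactors_eq_labels [NeZero ℓ] {p : ℓ.Partition} {M : ℕ} (hM : M ≠ 0)
    {s : Fin (ℓ + 1) → ℤ} (hs : ∀ i, (s i : ℝ) = M * affineRoot i (sigmaPoint p)) :
    removeCommonFactors s = removeCommonFactors (labels p) := by
  refine removeCommonFactors_eq_of_mul_eq_mul (a := bigM p) (b := M)
    (mod_cast Nat.pos_of_ne_zero (bigM_ne_zero p)) (mod_cast Nat.pos_of_ne_zero hM) fun i => ?_
  have : (bigM p * s i : ℝ) = M * labels p i := by rw [hs, cast_labels, mul_left_comm]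
  exact_mod_cast this

theorem isCocharacter_orderOf_smul_sigmaPoint {p : ℓ.Partition} {n : ↥(normTorus ℓ)}
    (hn : ConjClasses.mk (toWeyl n) = ellipticClass p) :
    IsCocharacter π ((orderOf (π n) : ℝ) • sigmaPoint p) := by
  have hconj := π.map_isConj (isConj_torusExp_sigmaPoint_zpow hn isCoprime_one_left)
  rw [zpow_one] at hconj
  rw [isCocharacter_iff, Nat.cast_smul_eq_nsmul, AddChar.map_nsmul_eq_pow, map_pow,
    orderOf_eq_of_isConj hconj, pow_orderOf_eq_one]

theorem isKacDiagram_map_iff [NeZero ℓ] (hπ : Function.Surjective π)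
    (hker : π.ker ≤ Subgroup.center (Sp ℓ)) {p : ℓ.Partition} {n : ↥(normTorus ℓ)}
    (hn : ConjClasses.mk (toWeyl n) = ellipticClass p) (hfin : IsOfFinOrder (π n)) {ξ : ℂˣ}
    (hξ : IsPrimitiveRoot ξ (orderOf (π n))) {d : Fin (ℓ + 1) → ℤ} :
    IsKacDiagram π ξ (π n) d ↔ d = removeCommonFactors (labels p) := by
  have hM := hfin.orderOf_pos.ne'
  obtain ⟨k, hk, cocharValue_eq⟩ := exists_isCoprime_cocharValue_eq (π := π) hM hξ
  simp only [isKacDiagram_iff hfin hξ, cocharValue_eq]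
  constructor
  · rintro ⟨x, hx, hcochar, hconj, s, hs, rfl⟩
    obtain rfl := eq_sigmaPoint_of_isConj hπ hker hn hk hx hcochar hconj
    exact removeCommonFactors_eq_labels hM hs
  · rintro rfl
    have hcochar : IsCocharacter π ((orderOf (π n) : ℝ) • sigmaPoint p) :=
      isCocharacter_orderOf_smul_sigmaPoint hn
    have hconj : IsConj (π n) (π (torusExp ℓ (sigmaPoint p) ^ k)) := π.map_isConj <|
      isConj_torusExp_sigmaPoint_zpow hn (isCoprime_two_mul_orderOf_map hker hn hk).2
    choose s hs using exists_mul_affineRoot_eq hker hcochar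
    exact ⟨sigmaPoint p, sigmaPoint_mem_closedAlcove p, hcochar, hconj, s, hs,
      (removeCommonFactors_eq_labels hM hs).symm⟩

end KacDiagrams

end KacC

end

theorem mainTheorem6 (ℓ : ℕ) (hℓ : 2 ≤ ℓ) (p : ℓ.Partition)
    {G : Type*} [Group G] (π : KacC.Sp ℓ →* G) (hπ : Function.Surjective π)
    (hker : π.ker ≤ Subgroup.center (KacC.Sp ℓ))
    (n : ↥(KacC.normTorus ℓ)) (hn : ConjClasses.mk (KacC.toWeyl n) = KacC.ellipticClass p) :
    orderOf (n : KacC.Sp ℓ) = KacC.bigM p ∧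
    IsOfFinOrder (π n) ∧
    ∀ ξ : ℂˣ, IsPrimitiveRoot ξ (orderOf (π n)) → ∀ d : Fin (ℓ + 1) → ℤ,
      KacC.IsKacDiagram π ξ (π n) d ↔ d = KacC.removeCommonFactors (KacC.labels p) := by
  have : NeZero ℓ := ⟨(two_pos.trans_le hℓ).ne'⟩
  have order_n := KacC.orderOf_eq_bigM hn
  have finite_order : IsOfFinOrder (π n) := π.isOfFinOrder <|
    orderOf_pos_iff.1 (order_n ▸ Nat.pos_of_ne_zero (KacC.bigM_ne_zero p))
  exact ⟨order_n, finite_order, fun ξ hξ d => KacC.isKacDiagram_map_iff hπ hker hn finite_order hξ⟩
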